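/- Let $\mathrm{M}$ be a loopless matroid of rank $r+1$ on a finite set $E$, where $r\ge 0$, and let $\mathscr{P}$ be an order filter of the poset of nonempty proper flats of $\mathrm{M}$; that is, $\mathscr{P}$ is a (possibly empty) collection of nonempty proper flats such that, whenever $F_1\subseteq F_2$ are nonempty proper flats, $F_1\in\mathscr{P}$ implies $F_2\in\mathscr{P}$. Let $A^*(\mathrm{M},\mathscr{P})$ be the Chow ring of $(\mathrm{M},\mathscr{P})$: the quotient of the polynomial ring $\mathbb{Z}[x_i,x_F]_{i\in E,\,F\in\mathscr{P}}$ by the homogeneous ideal generated by 1. the monomials $x_{F_1}x_{F_2}$, for incomparable $F_1,F_2\in\mathscr{P}$; 2. the monomials $x_i x_F$, for $F\in\mathscr{P}$ and $i\in E\setminus F$; 3. the monomials $\prod_{i\in I}x_i$, for independent sets $I$ of $\mathrm{M}$ whose closure is in $\mathscr{P}\cup\{E\}$; 4. the linear forms $\big(x_i+\sum_{i\in F}x_F\big)-\big(x_j+\sum_{j\in F}x_F\big)$, for distinct $i,j\in E$, where the sums are over the flats $F$ in $\mathscr{P}$ that contain $i$, respectively $j$. Let $A^q(\mathrm{M},\mathscr{P})$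 be its homogeneous part of degree $q$. Then the following hold. (a) $A^r(\mathrm{M},\mathscr{P})\simeq\mathbb{Z}$ as groups. (b) For every integer $0\le q\le r$, the multiplication map $A^{q}(\mathrm{M},\mathscr{P})\times A^{r-q}(\mathrm{M},\mathscr{P})\to A^r(\mathrm{M},\mathscr{P})$ defines an isomorphism of groups $$A^{r-q}(\mathrm{M},\mathscr{P})\longrightarrow \mathrm{Hom}_{\mathbb{Z}}\big(A^{q}(\mathrm{M},\mathscr{P}),A^r(\mathrm{M},\mathscr{P})\big),\qquad b\longmapsto (a\mapsto ab).$$ (c) In particular, the group $A^q(\mathrm{M},\mathscr{P})$ is torsion free for every $q\ge 0$. -/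

import Mathlib

/-!
  The Chow ring of a pair `(M, P)`, where `M` is a matroid on a finite ground set and `P` is an
  order filter of nonempty proper flats of `M`.
-/

namespace MatroidChow

/-- `P` is an order filter of the poset of nonempty proper flats of `M`. (The ground set is finite
in all uses, so that a collection of flats is a finite set.) -/
structure IsOrderFilter {α : Type*} (M : Matroid α) (P : Finset (Set α)) : Prop where
  isFlat : ∀ F ∈ P, M.IsFlat F
  nonempty : ∀ F ∈ P, F.Nonempty
  ne_ground : ∀ F ∈ P, F ≠ M.E
  mem_of_subset : ∀ F ∈ P, ∀ G, M.IsFlat G → G ≠ M.E → F ⊆ G → G ∈ P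

/-- The index set of the variables: the disjoint union of the ground set and `P`. -/
abbrev Vars {α : Type*} (M : Matroid α) (P : Finset (Set α)) : Type _ :=
  {i : α // i ∈ M.E} ⊕ {F : Set α // F ∈ P}

/-- The polynomial ring over `ℤ` with variables `x_i`, `i ∈ E`, and `x_F`, `F ∈ P`. -/
abbrev PolyRing {α : Type*} (M : Matroid α) (P : Finset (Set α)) : Type _ :=
  MvPolynomial (Vars M P) ℤ

section Relations

variable {α : Type*} (M : Matroid α) (P : Finset (Set α))

/-- The variable `x_i`. -/
noncomputable def xE (i : {i : α // i ∈ M.E}) : PolyRing M P := MvPolynomial.X (Sum.inl i)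

/-- The variable `x_F`. -/
noncomputable def xF (F : {F : Set α // F ∈ P}) : PolyRing M P := MvPolynomial.X (Sum.inr F)

/-- Incomparability relations: `x_F x_G` for incomparable `F` and `G` in `P`. -/
def incomparabilityRels : Set (PolyRing M P) :=
  {f | ∃ F G : {F : Set α // F ∈ P}, ¬ F.1 ⊆ G.1 ∧ ¬ G.1 ⊆ F.1 ∧ f = xF M P F * xF M P G}

/-- Complement relations: `x_i x_F` for `F` in `P` and `i` in `E \ F`. -/
def complementRels : Set (PolyRing M P) :=
  {f | ∃ (i : {i : α // i ∈ M.E}) (F : {F : Set α // F ∈ P}),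
    i.1 ∉ F.1 ∧ f = xE M P i * xF M P F}

/-- Closure relations: `∏_{i ∈ I} x_i` for `I` independent with closure in `P ∪ {E}`. -/
def closureRels : Set (PolyRing M P) :=
  {f | ∃ I : Finset {i : α // i ∈ M.E},
    M.Indep (Subtype.val '' (I : Set {i : α // i ∈ M.E})) ∧
    (M.closure (Subtype.val '' (I : Set {i : α // i ∈ M.E})) ∈ P ∨
      M.closure (Subtype.val '' (I : Set {i : α // i ∈ M.E})) = M.E) ∧
    f = ∏ i ∈ I, xE M P i}

open Classical in
/-- The linear form `x_i + ∑_{i ∈ F} x_F`, where the sum is over `F` in `P`. -/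
noncomputable def linForm (i : {i : α // i ∈ M.E}) : PolyRing M P :=
  xE M P i + ∑ F : {F : Set α // F ∈ P} with i.1 ∈ F.1, xF M P F

/-- Linear relations: the differences of the linear forms for distinct `i` and `j` in `E`. -/
def linearRels : Set (PolyRing M P) :=
  {f | ∃ i j : {i : α // i ∈ M.E}, i ≠ j ∧ f = linForm M P i - linForm M P j}

/-- The sum of the four ideals of relations. -/
noncomputable def relIdeal : Ideal (PolyRing M P) :=
  Ideal.span (incomparabilityRels M P) ⊔ Ideal.span (complementRels M P) ⊔
    Ideal.span (closureRels M P) ⊔ Ideal.span (linearRels M P)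

/-- The Chow ring `A^*(M, P)`. -/
abbrev ChowRing : Type _ := PolyRing M P ⧸ relIdeal M P

/-- The group `A^q(M, P)`: the classes of the homogeneous polynomials of degree `q`. -/
noncomputable def chowPiece (q : ℕ) : Submodule ℤ (ChowRing M P) :=
  (MvPolynomial.homogeneousSubmodule (Vars M P) ℤ q).map
    (Ideal.Quotient.mkₐ ℤ (relIdeal M P)).toLinearMap

variable {M P}

theorem mul_mem_chowPiece {p q r : ℕ} (h : p + q = r) {a b : ChowRing M P}
    (ha : a ∈ chowPiece M P p) (hb : b ∈ chowPiece M P q) : a * b ∈ chowPiece M P r := by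
  subst h
  obtain ⟨f, hf, rfl⟩ := ha
  obtain ⟨g, hg, rfl⟩ := hb
  exact ⟨f * g, MvPolynomial.IsHomogeneous.mul hf hg, map_mul (Ideal.Quotient.mkₐ ℤ _) f g⟩

variable (M P)

/-- The homomorphism `A^p(M, P) → Hom_ℤ(A^q(M, P), A^r(M, P))`, where `p + q = r`, that sends `b`
to `a ↦ a * b`. -/
noncomputable def chowPairing {p q r : ℕ} (h : p + q = r) :
    chowPiece M P p →ₗ[ℤ] (chowPiece M P q →ₗ[ℤ] chowPiece M P r) :=
  LinearMap.mk₂ ℤ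
    (fun b a => ⟨a.1 * b.1, mul_mem_chowPiece ((Nat.add_comm q p).trans h) a.2 b.2⟩)
    (fun b b' a => Subtype.ext (mul_add a.1 b.1 b'.1))
    (fun n b a => Subtype.ext (mul_smul_comm n a.1 b.1))
    (fun b a a' => Subtype.ext (add_mul a.1 a'.1 b.1))
    (fun n b a => Subtype.ext (smul_mul_assoc n a.1 b.1))

end Relations

end MatroidChow

/-! Let `a` be the common class of the linear forms and put h_F = a - ∑ x_G, the sum over G in P
containing F. Then h_E = a, and x_i is the class h of {i}. The h_F with F in P ∪ {E} generate the
ring, and the defining relations imply (h_F - h_J)(h_G - h_J) = 0 for J the join of F and G; h_F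
h_G^c = h_G^(c+1) and x_F h_G^c = 0 for F ⊂ G and c ≥ rk G - rk F (the second for F in P); h_F^c = 0
for F in P ∪ {E} and c ≥ rk F. Used as rewriting rules, the relations among the h_F either kill a
monomial or raise its total rank. Hence A^q is spanned by the reduced monomials: products along
chains F_1 ⊂ ... ⊂ F_k in P ∪ {E} with exponents m_i < rk F_i - rk F_(i-1), where rk F_0 = 0
(`chowPiece_le_reducedSpan`).

Nothing so far prevents collapse. For that, a functional on polynomials in free variables X_F sends
a monomial to 1 or 0 according to the dragon Hall–Rado condition. Submodularity of the rank shows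
that the join relation lies in the largest ideal inside its kernel (`isHallRado_join`). Möbius
inversion of -X_F then produces elements of the quotient that satisfy the Chow relations
(`isChowFamily_flatVar`), which gives a degree map D with D(a^r) = 1 (`exists_degree`).

Each reduced monomial T has an explicit partner of degree r - q: the product of x_F over the members
F ≠ E of T, times powers of the h_F that fill the rank jumps. The product of T with its own partner
is a^r, and the product of C with the partner of T vanishes if some F in P belonging to T contains
fewer members of C than of T. So the pairing matrix is unitriangular over ℤ (`isUnit_det_pairing`).
Thus the reduced monomials form a basis, every integer functional on A^q is a pairing, and all three
claims follow. -/

namespace MatroidChow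

/-! ### Ranks and joins of flats. -/

section Rank

variable {α : Type*} (M : Matroid α)

/-- The rank of a set as a natural number. -/
noncomputable def rk (X : Set α) : ℕ := (M.eRk X).toNat

theorem rk_empty : rk M ∅ = 0 := by simp [rk]

theorem rk_closure_union (X Y : Set α) : rk M (M.closure X ∪ Y) = rk M (X ∪ Y) := by
  simp [rk]

theorem rk_closure (X : Set α) : rk M (M.closure X) = rk M X := by
  simp [rk]

variable {M}

theorem closure_insert_subset {F G : Set α} (hG : M.IsFlat G) (hFG : F ⊆ G) {i : α}
    (hiG : i ∈ G) : M.closure (insert i F) ⊆ G := by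
  rw [← hG.closure]
  exact M.closure_subset_closure (Set.insert_subset hiG hFG)

/-- The join of two sets in the lattice of flats. -/
abbrev join (M : Matroid α) (F G : Set α) : Set α := M.closure (F ∪ G)

theorem join_subset_iff {F G H : Set α} (hH : M.IsFlat H) (hF : F ⊆ M.E) (hG : G ⊆ M.E) :
    join M F G ⊆ H ↔ F ⊆ H ∧ G ⊆ H := by
  rw [← Set.union_subset_iff]
  constructor
  · exact (M.subset_closure _ (Set.union_subset hF hG)).trans
  · intro h
    rw [← hH.closure]
    exact M.closure_subset_closure h

theorem left_subset_join {F G : Set α} (hF : F ⊆ M.E) : F ⊆ join M F G :=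
  M.subset_closure_of_subset' Set.subset_union_left hF

theorem right_subset_join {F G : Set α} (hG : G ⊆ M.E) : G ⊆ join M F G :=
  M.subset_closure_of_subset' Set.subset_union_right hG

theorem isFlat_empty [M.Loopless] : M.IsFlat ∅ := by
  have h : M.closure ∅ = ∅ := Matroid.loops_eq_empty M
  rw [← h]
  exact M.isFlat_closure ∅

variable (M) [M.Finite]

theorem coe_rk (X : Set α) : (rk M X : ℕ∞) = M.eRk X :=
  ENat.natCast_toNat (Matroid.eRk_ne_top_iff.2 (Matroid.RankFinite.isRkFinite X))

theorem rk_mono {X Y : Set α} (h : X ⊆ Y) : rk M X ≤ rk M Y := by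
  have := M.eRk_mono h
  rw [← coe_rk, ← coe_rk] at this
  exact_mod_cast this

theorem rk_inter_add_rk_union_le (X Y : Set α) :
    rk M (X ∩ Y) + rk M (X ∪ Y) ≤ rk M X + rk M Y := by
  have := M.eRk_inter_add_eRk_union_le X Y
  simp only [← coe_rk] at this
  exact_mod_cast this

theorem rk_singleton_le (i : α) : rk M {i} ≤ 1 := by
  have := M.eRk_le_encard {i}
  rw [← coe_rk, Set.encard_singleton] at this
  exact_mod_cast this

variable {M}

theorem rk_closure_insert {F : Set α} (hF : M.IsFlat F) {i : α} (hi : i ∈ M.E) (hiF : i ∉ F) :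
    rk M (M.closure (insert i F)) = rk M F + 1 := by
  have h := M.eRk_insert_eq_add_one (e := i) (X := F) ⟨hi, by rwa [hF.closure]⟩
  rw [rk_closure]
  simp only [← coe_rk] at h
  exact_mod_cast h

theorem rk_lt_rk {F G : Set α} (hF : M.IsFlat F) (hG : M.IsFlat G) (hFG : F ⊂ G) :
    rk M F < rk M G := by
  obtain ⟨i, hiG, hiF⟩ := Set.exists_of_ssubset hFG
  have h := rk_closure_insert hF (hG.subset_ground hiG) hiF
  have h' := rk_mono M (closure_insert_subset hG hFG.1 hiG)
  omega

theorem exists_indep_closure_eq {F : Set α} (hF : M.IsFlat F) :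
    ∃ I : Finset α, M.Indep (I : Set α) ∧ M.closure (I : Set α) = F ∧ I.card = rk M F := by
  obtain ⟨I, hI⟩ := M.exists_isBasis F hF.subset_ground
  have hfin : I.Finite := M.ground_finite.subset hI.indep.subset_ground
  lift I to Finset α using hfin
  refine ⟨I, hI.indep, by rw [hI.closure_eq_closure, hF.closure], ?_⟩
  have := hI.encard_eq_eRk
  rw [← coe_rk, Set.encard_coe_eq_coe_finsetCard] at this
  exact_mod_cast this

theorem rk_pos [M.Loopless] {F : Set α} (hF : M.IsFlat F) (hne : F.Nonempty) : 0 < rk M F := by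
  simpa [rk_empty] using rk_lt_rk isFlat_empty hF (Set.empty_ssubset.2 hne)

end Rank

/-! ### Chow families and the relations among the classes h_F. -/

section Family

open Classical

variable {α : Type*} {M : Matroid α} {P : Finset (Set α)} {A : Type*} [CommRing A]

/-- The class `a - ∑ x_G`, where the sum is over the members `G` of `P` that contain `F`. -/
noncomputable def hClass (P : Finset (Set α)) (x : Set α → A) (a : A) (F : Set α) : A :=
  a - ∑ G ∈ P with F ⊆ G, x G

/-- Elements of a commutative ring that satisfy the relations of the Chow ring of `(M, P)`; the
classes of the elements `i` of the ground set are `hClass P x a {i}`. -/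
structure IsChowFamily (M : Matroid α) (P : Finset (Set α)) (x : Set α → A) (a : A) : Prop where
  incomparable : ∀ F ∈ P, ∀ G ∈ P, ¬ F ⊆ G → ¬ G ⊆ F → x F * x G = 0
  complement : ∀ F ∈ P, ∀ i ∈ M.E, i ∉ F → x F * hClass P x a {i} = 0
  closure : ∀ I : Finset α, M.Indep (I : Set α) →
    (M.closure (I : Set α) ∈ P ∨ M.closure (I : Set α) = M.E) →
    ∏ i ∈ I, hClass P x a {i} = 0

theorem IsOrderFilter.isFlat' (hP : IsOrderFilter M P) {F : Set α} (hF : F ∈ insert M.E P) :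
    M.IsFlat F := by
  rcases Finset.mem_insert.1 hF with rfl | h
  · exact M.ground_isFlat
  · exact hP.isFlat F h

theorem IsOrderFilter.mem_of_subset' (hP : IsOrderFilter M P) {F G : Set α}
    (hF : F ∈ insert M.E P) (hG : M.IsFlat G) (h : F ⊆ G) : G ∈ insert M.E P := by
  by_cases hGE : G = M.E
  · simp [hGE]
  · rcases Finset.mem_insert.1 hF with rfl | hF
    · exact absurd (hG.subset_ground.antisymm h) hGE
    · exact Finset.mem_insert_of_mem (hP.mem_of_subset F hF G hG hGE h)

variable {x : Set α → A} {a : A}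

theorem hClass_ground (hP : IsOrderFilter M P) : hClass P x a M.E = a := by
  rw [hClass, Finset.filter_false_of_mem, Finset.sum_empty, sub_zero]
  intro G hG h
  exact hP.ne_ground G hG ((hP.isFlat G hG).subset_ground.antisymm h)

theorem hClass_sub_hClass {F G : Set α} (hFG : F ⊆ G) :
    hClass P x a G - hClass P x a F = ∑ B ∈ P with F ⊆ B ∧ ¬ G ⊆ B, x B := by
  have h : ∑ B ∈ P with F ⊆ B, x B =
      ∑ B ∈ P with G ⊆ B, x B + ∑ B ∈ P with F ⊆ B ∧ ¬ G ⊆ B, x B := by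
    rw [← Finset.sum_filter_add_sum_filter_not (P.filter (F ⊆ ·)) (G ⊆ ·),
      Finset.filter_filter, Finset.filter_filter]
    congr 2
    ext B
    simp only [Finset.mem_filter]
    exact ⟨fun h => ⟨h.1, h.2.2⟩, fun h => ⟨h.1, hFG.trans h.2, h.2⟩⟩
  rw [hClass, hClass, h]
  ring

namespace IsChowFamily

variable (hx : IsChowFamily M P x a) (hP : IsOrderFilter M P)
include hx hP

/-- The two classes differ by those x_C with G ⊆ C and B ⊄ C. Since G ⊄ B, each such C is
incomparable to B. -/
theorem x_mul_hClass_join {B G : Set α} (hB : B ∈ P) (hG : G ⊆ M.E) (hGB : ¬ G ⊆ B) :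
    x B * hClass P x a G = x B * hClass P x a (join M G B) := by
  have h : x B * (hClass P x a (join M G B) - hClass P x a G) = 0 := by
    rw [hClass_sub_hClass (left_subset_join hG), Finset.mul_sum]
    refine Finset.sum_eq_zero fun C hC => ?_
    rw [Finset.mem_filter] at hC
    rw [join_subset_iff (hP.isFlat C hC.1) hG (hP.isFlat B hB).subset_ground] at hC
    exact hx.incomparable B hB C hC.1 (fun h => hC.2.2 ⟨hC.2.1, h⟩) fun h => hGB (hC.2.1.trans h)
  rw [mul_sub, sub_eq_zero] at h
  exact h.symm

theorem x_mul_hClass_closure_insert {B : Set α} (hB : B ∈ P) {i : α} (hi : i ∈ M.E)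
    (hiB : i ∉ B) : x B * hClass P x a (M.closure (insert i B)) = 0 := by
  have := hx.x_mul_hClass_join hP hB (Set.singleton_subset_iff.2 hi) (by simpa using hiB)
  rw [hx.complement B hB i hi hiB] at this
  exact this.symm

theorem hClass_sub_join_mul {F G : Set α} (hF : F ⊆ M.E) (hG : G ⊆ M.E) :
    (hClass P x a F - hClass P x a (join M F G)) *
      (hClass P x a G - hClass P x a (join M F G)) = 0 := by
  rw [← neg_sub, ← neg_sub (hClass P x a (join M F G)) (hClass P x a G), neg_mul_neg,
    hClass_sub_hClass (left_subset_join hF), hClass_sub_hClass (right_subset_join hG),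
    Finset.sum_mul_sum]
  refine Finset.sum_eq_zero fun B hB => Finset.sum_eq_zero fun C hC => ?_
  rw [Finset.mem_filter] at hB hC
  rw [join_subset_iff (hP.isFlat _ hB.1) hF hG] at hB
  rw [join_subset_iff (hP.isFlat _ hC.1) hF hG] at hC
  exact hx.incomparable B hB.1 C hC.1 (fun h => hC.2.2 ⟨hB.2.1.trans h, hC.2.1⟩)
    fun h => hB.2.2 ⟨hB.2.1, hC.2.1.trans h⟩

/-- With H the closure of F ∪ {i}, h_H - h_F is a sum of x_B with F ⊆ B and i ∉ B. For these, x_B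
h_H equals x_B times the class of the closure of B ∪ {i}, hence x_B x_i = 0. -/
theorem hClass_mul_hClass_closure_insert {F : Set α} (hF : F ⊆ M.E) {i : α} (hi : i ∈ M.E) :
    hClass P x a F * hClass P x a (M.closure (insert i F)) =
      hClass P x a (M.closure (insert i F)) ^ 2 := by
  have hFG : F ⊆ M.closure (insert i F) :=
    M.subset_closure_of_subset' (Set.subset_insert i F) hF
  have hins : insert i F ⊆ M.E := Set.insert_subset hi hF
  have h : (hClass P x a (M.closure (insert i F)) - hClass P x a F) *
      hClass P x a (M.closure (insert i F)) = 0 := by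
    rw [hClass_sub_hClass hFG, Finset.sum_mul]
    refine Finset.sum_eq_zero fun B hB => ?_
    rw [Finset.mem_filter] at hB
    obtain ⟨hB, hFB, hGB⟩ := hB
    have hBf := hP.isFlat B hB
    rw [hx.x_mul_hClass_join hP hB (M.closure_subset_ground _) hGB,
      join, M.closure_union_closure_left_eq, Set.insert_union, Set.union_eq_self_of_subset_left hFB]
    exact hx.x_mul_hClass_closure_insert hP hB hi fun hiB => hGB (closure_insert_subset hBf hFB hiB)
  rw [sub_mul, sub_eq_zero] at h
  rw [← h, sq]

variable [M.Finite]

/-- Climb from F to G through H, the closure of F ∪ {i} with i in G \ F. By induction one factor h_H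
can be created out of a power of h_G; then h_F h_H = h_H^2, respectively x_F h_H = 0, finishes. -/
theorem hClass_mul_pow_and_x_mul_pow {G : Set α} (hG : M.IsFlat G) (n : ℕ) :
    ∀ F : Set α, M.IsFlat F → F ⊂ G → rk M G ≤ rk M F + n →
      (∀ c, n ≤ c → hClass P x a F * hClass P x a G ^ c = hClass P x a G ^ (c + 1)) ∧
      (F ∈ P → ∀ c, n ≤ c → x F * hClass P x a G ^ c = 0) := by
  induction n with
  | zero =>
    intro F hF hFG hn
    have := rk_lt_rk hF hG hFG
    omega
  | succ n ih =>
    intro F hF hFG hn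
    obtain ⟨i, hiG, hiF⟩ := Set.exists_of_ssubset hFG
    have hi := hG.subset_ground hiG
    set H := M.closure (insert i F) with hH
    have hHG : H ⊆ G := closure_insert_subset hG hFG.1 hiG
    have hFH : hClass P x a F * hClass P x a H = hClass P x a H ^ 2 :=
      hx.hClass_mul_hClass_closure_insert hP hF.subset_ground hi
    have hxH : F ∈ P → x F * hClass P x a H = 0 := fun h =>
      hx.x_mul_hClass_closure_insert hP h hi hiF
    have key : ∀ c, n ≤ c → hClass P x a H * hClass P x a G ^ c = hClass P x a G ^ (c + 1) := by
      rcases hHG.eq_or_ssubset with h | h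
      · intro c _
        rw [h, pow_succ']
      · have : rk M H = _ := rk_closure_insert hF hi hiF
        exact (ih H (M.isFlat_closure _) h (by omega)).1
    refine ⟨fun c hc => ?_, fun hFP c hc => ?_⟩
    · obtain ⟨c, rfl⟩ : ∃ d, c = d + 1 := ⟨c - 1, by omega⟩
      rw [← key c (by omega), ← mul_assoc, hFH, sq, mul_assoc, key c (by omega),
        key (c + 1) (by omega)]
    · obtain ⟨c, rfl⟩ : ∃ d, c = d + 1 := ⟨c - 1, by omega⟩
      rw [← key c (by omega), ← mul_assoc, hxH hFP, zero_mul]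

theorem hClass_mul_pow {F G : Set α} (hF : M.IsFlat F) (hG : M.IsFlat G) (hFG : F ⊂ G) {c : ℕ}
    (hc : rk M G ≤ rk M F + c) :
    hClass P x a F * hClass P x a G ^ c = hClass P x a G ^ (c + 1) :=
  (hx.hClass_mul_pow_and_x_mul_pow hP hG c F hF hFG hc).1 c le_rfl

theorem x_mul_pow {F G : Set α} (hF : F ∈ P) (hG : M.IsFlat G) (hFG : F ⊂ G) {c : ℕ}
    (hc : rk M G ≤ rk M F + c) : x F * hClass P x a G ^ c = 0 :=
  (hx.hClass_mul_pow_and_x_mul_pow hP hG c F (hP.isFlat F hF) hFG hc).2 hF c le_rfl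

end IsChowFamily

end Family

/-! ### Straightening products of the h_F into reduced monomials. -/

section Straightening

open Classical

variable {α : Type*} {M : Matroid α} {P : Finset (Set α)} {A : Type*} [CommRing A]

/-- Expand: each term picks z_i or some y_B with i ∈ B. If not all picks are z_i, a maximal picked B
omits some i in I. Either z_i was picked and y_B z_i = 0, or the set picked at i contains i and is
incomparable to B. -/
theorem prod_add_sum_eq_zero (I : Finset α) (z : α → A) (y : Set α → A)
    (s : α → Finset (Set α)) (hz : ∏ i ∈ I, z i = 0) (hs : ∀ i ∈ I, ∀ B ∈ s i, i ∈ B)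
    (hI : ∀ j ∈ I, ∀ B ∈ s j, ∃ i ∈ I, i ∉ B)
    (hyz : ∀ j ∈ I, ∀ B ∈ s j, ∀ i ∈ I, i ∉ B → y B * z i = 0)
    (hy : ∀ i ∈ I, ∀ j ∈ I, ∀ B ∈ s i, ∀ C ∈ s j, ¬ B ⊆ C → ¬ C ⊆ B → y B * y C = 0) :
    ∏ i ∈ I, (z i + ∑ B ∈ s i, y B) = 0 := by
  rw [Finset.prod_add]
  refine Finset.sum_eq_zero fun t ht => ?_
  rw [Finset.mem_powerset] at ht
  rcases ht.eq_or_ssubset with rfl | hlt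
  · rw [hz, zero_mul]
  rw [Finset.prod_sum, Finset.mul_sum]
  refine Finset.sum_eq_zero fun p hp => ?_
  rw [Finset.mem_pi] at hp
  obtain ⟨i₀, hi₀⟩ : (I \ t).Nonempty := Finset.sdiff_nonempty.2 hlt.2
  obtain ⟨k, -, hk⟩ := Finset.exists_maximalFor
    (fun k : {k // k ∈ I \ t} => p k.1 k.2) (I \ t).attach ⟨⟨i₀, hi₀⟩, Finset.mem_attach _ _⟩
  have hkI := (Finset.mem_sdiff.1 k.2).1
  obtain ⟨i, hi, hik⟩ := hI k.1 hkI _ (hp k.1 k.2)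
  by_cases hit : i ∈ t
  · have h1 : z i ∣ ∏ i ∈ t, z i := Finset.dvd_prod_of_mem z hit
    have h2 := Finset.dvd_prod_of_mem (fun k : {k // k ∈ I \ t} => y (p k.1 k.2))
      (Finset.mem_attach _ k)
    have := mul_dvd_mul h1 h2
    rw [mul_comm (z i), hyz k.1 hkI _ (hp k.1 k.2) i hi hik] at this
    exact zero_dvd_iff.1 this
  · have hi' : i ∈ I \ t := Finset.mem_sdiff.2 ⟨hi, hit⟩
    have hne : k ≠ ⟨i, hi'⟩ := by
      rintro rfl
      exact hik (hs i hi _ (hp i hi'))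
    have h := Finset.prod_dvd_prod_of_subset {k, ⟨i, hi'⟩} (I \ t).attach
      (fun k : {k // k ∈ I \ t} => y (p k.1 k.2)) fun a _ => Finset.mem_attach _ a
    have hn : ¬ p i hi' ⊆ p k.1 k.2 := fun h => hik (h (hs i hi _ (hp i hi')))
    rw [Finset.prod_pair hne, hy k.1 hkI i hi _ (hp k.1 k.2) _ (hp i hi')
      (fun h => hn (hk (Finset.mem_attach _ ⟨i, hi'⟩) h)) hn, zero_dvd_iff] at h
    rw [h, mul_zero]

variable {x : Set α → A} {a : A}

/-- For a basis I of F and i in I, h_F = x_i + ∑ x_B over B containing i but not F. No such B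
contains I, so the product over I vanishes by the closure relation and `prod_add_sum_eq_zero`. -/
theorem IsChowFamily.hClass_pow_eq_zero [M.Finite] (hx : IsChowFamily M P x a)
    (hP : IsOrderFilter M P) {F : Set α} (hF : F ∈ insert M.E P) {c : ℕ} (hc : rk M F ≤ c) :
    hClass P x a F ^ c = 0 := by
  have hFf := hP.isFlat' hF
  obtain ⟨I, hI, hIF, hIc⟩ := exists_indep_closure_eq hFf
  have hsub : (I : Set α) ⊆ F := hIF ▸ M.subset_closure _ hI.subset_ground
  have key : ∏ i ∈ I, hClass P x a F = 0 := by
    have h : ∀ i ∈ I, hClass P x a F =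
        hClass P x a {i} + ∑ B ∈ P with {i} ⊆ B ∧ ¬ F ⊆ B, x B := fun i hi => by
      rw [← hClass_sub_hClass (Set.singleton_subset_iff.2 (hsub hi))]
      ring
    rw [Finset.prod_congr rfl h]
    refine prod_add_sum_eq_zero I _ _ _ (hx.closure I hI ?_) ?_ ?_ ?_ ?_
    · rw [hIF]
      exact (Finset.mem_insert.1 hF).symm
    · intro i hi B hB
      exact Set.singleton_subset_iff.1 (Finset.mem_filter.1 hB).2.1
    · intro j hj B hB
      rw [Finset.mem_filter] at hB
      by_contra! hcon
      refine hB.2.2 ?_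
      rw [← hIF, ← (hP.isFlat B hB.1).closure]
      exact M.closure_subset_closure hcon
    · intro j hj B hB i hi hiB
      exact hx.complement B (Finset.mem_filter.1 hB).1 i (hI.subset_ground hi) hiB
    · intro i hi j hj B hB C hC
      exact hx.incomparable B (Finset.mem_filter.1 hB).1 C (Finset.mem_filter.1 hC).1
  rw [Finset.prod_const, hIc] at key
  rw [← Nat.add_sub_of_le hc, pow_add, key, zero_mul]

/-- A multiset of sets is reduced over rank `n₀` if it is a chain in which the multiplicity of each
member is smaller than the jump of the rank below it, where the rank starts from `n₀`. -/
structure IsReduced (M : Matroid α) (n₀ : ℕ) (T : Multiset (Set α)) : Prop where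
  chain : ∀ F ∈ T, ∀ G ∈ T, F ⊆ G ∨ G ⊆ F
  count_add_lt : ∀ F ∈ T, T.count F + n₀ < rk M F
  count_add_rk_lt : ∀ F ∈ T, ∀ G ∈ T, G ⊂ F → T.count F + rk M G < rk M F

theorem exists_forall_subset_of_chain {T : Multiset (Set α)} (h0 : T ≠ 0)
    (hT : ∀ F ∈ T, ∀ G ∈ T, F ⊆ G ∨ G ⊆ F) : ∃ F ∈ T, ∀ G ∈ T, G ⊆ F := by
  obtain ⟨F₀, hF₀⟩ := Multiset.exists_mem_of_ne_zero h0
  obtain ⟨F, hF, hmax⟩ := Finset.exists_maximal (s := T.toFinset) ⟨F₀, by simpa using hF₀⟩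
  rw [Multiset.mem_toFinset] at hF
  refine ⟨F, hF, fun G hG => ?_⟩
  rcases hT F hF G hG with h | h
  · exact hmax (by simpa using hG) h
  · exact h

theorem IsReduced.filter_ne {n₀ : ℕ} {T : Multiset (Set α)} (hT : IsReduced M n₀ T) (F : Set α) :
    IsReduced M n₀ (T.filter (· ≠ F)) where
  chain G hG H hH := hT.chain G (Multiset.mem_of_mem_filter hG) H (Multiset.mem_of_mem_filter hH)
  count_add_lt G hG := by
    rw [Multiset.count_filter_of_pos (Multiset.of_mem_filter hG)]
    exact hT.count_add_lt G (Multiset.mem_of_mem_filter hG)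
  count_add_rk_lt G hG H hH h := by
    rw [Multiset.count_filter_of_pos (Multiset.of_mem_filter hG)]
    exact hT.count_add_rk_lt G (Multiset.mem_of_mem_filter hG) H (Multiset.mem_of_mem_filter hH) h

theorem card_eq_count_add_card_filter_ne (T : Multiset (Set α)) (F : Set α) :
    T.card = T.count F + (T.filter (· ≠ F)).card := by
  rw [Multiset.count, Multiset.countP_eq_card_filter, ← Multiset.card_add]
  conv_lhs => rw [← Multiset.filter_add_not (F = ·) T]
  simp only [ne_eq, eq_comm]

/-- Multiplicities stay below the rank jumps along the chain, and these telescope; the induction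
strips off the largest member. -/
theorem IsReduced.card_add_lt [M.Finite] {n₀ : ℕ} (n : ℕ) : ∀ {T : Multiset (Set α)} {F : Set α},
    T.card ≤ n → IsReduced M n₀ T → (∀ G ∈ T, G ⊆ F) → n₀ < rk M F → T.card + n₀ < rk M F := by
  induction n with
  | zero =>
    intro T F hn _ _ h
    omega
  | succ n ih =>
    intro T F hn hT hTF h
    by_cases h0 : T = 0
    · simpa [h0] using h
    obtain ⟨G, hG, hGtop⟩ := exists_forall_subset_of_chain h0 hT.chain
    have hle := rk_mono M (hTF G hG)
    have hpos := Multiset.count_pos.2 hG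
    have hcard := card_eq_count_add_card_filter_ne T G
    have hcount := hT.count_add_lt G hG
    by_cases h1 : T.filter (· ≠ G) = 0
    · rw [h1, Multiset.card_zero] at hcard
      omega
    obtain ⟨H, hH, hHtop⟩ := exists_forall_subset_of_chain h1 (hT.filter_ne G).chain
    have hH' := Multiset.mem_filter.1 hH
    have hrk := hT.count_add_rk_lt G hG H hH'.1 ((hGtop H hH'.1).ssubset_of_ne hH'.2)
    have := ih (by omega) (hT.filter_ne G) hHtop (by have := hT.count_add_lt H hH'.1; omega)
    omega

/-- The span of the multiples by `z` of the products of `q` classes `h_F` that form a reduced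
multiset of members of `R`. -/
def reducedSpan (M : Matroid α) (h : Set α → A) (z : A) (n₀ : ℕ) (R : Set (Set α)) (q : ℕ) :
    Submodule ℤ A :=
  Submodule.span ℤ {b | ∃ T : Multiset (Set α), (∀ F ∈ T, F ∈ R) ∧ IsReduced M n₀ T ∧
    T.card = q ∧ b = z * (T.map h).prod}

/-- `n` bounds the distance of the total rank of `S` from its maximum. The join relation and h_G
h_F^c = h_F^(c+1) both raise the total rank, while a multiplicity too large relative to `n₀` gives
zero by `hz`. Both z = 1 with `n₀` = 0 and z = x_F with `n₀` = rk F are needed. -/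
theorem IsChowFamily.mul_prod_mem_reducedSpan [M.Finite] (hx : IsChowFamily M P x a)
    (hP : IsOrderFilter M P) {z : A} {n₀ : ℕ} {R : Set (Set α)} (hR : ∀ F ∈ R, M.IsFlat F)
    (hR' : ∀ F ∈ R, ∀ G, M.IsFlat G → F ⊆ G → G ∈ R)
    (hz : ∀ F ∈ R, ∀ c, rk M F ≤ c + n₀ → z * hClass P x a F ^ c = 0) (n : ℕ) :
    ∀ S : Multiset (Set α), (∀ F ∈ S, F ∈ R) →
      S.card * rk M M.E < (S.map (rk M)).sum + n →
      z * (S.map (hClass P x a)).prod ∈ reducedSpan M (hClass P x a) z n₀ R S.card := by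
  induction n with
  | zero =>
    intro S hS hn
    have := Multiset.sum_le_card_nsmul (S.map (rk M)) (rk M M.E) (by
      intro m hm
      obtain ⟨F, hF, rfl⟩ := Multiset.mem_map.1 hm
      exact rk_mono M (hR F (hS F hF)).subset_ground)
    rw [Multiset.card_map, smul_eq_mul] at this
    omega
  | succ n ih =>
    intro S hS hn
    by_cases hred : IsReduced M n₀ S
    · exact Submodule.subset_span ⟨S, hS, hred, rfl, rfl⟩
    by_cases hchain : ∀ F ∈ S, ∀ G ∈ S, F ⊆ G ∨ G ⊆ F
    · by_cases hcount : ∀ F ∈ S, S.count F + n₀ < rk M F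
      · have : ∃ F ∈ S, ∃ G ∈ S, G ⊂ F ∧ rk M F ≤ S.count F + rk M G := by
          by_contra! hcon
          exact hred ⟨hchain, hcount, hcon⟩
        obtain ⟨F, hF, G, hG, hGF, hrk⟩ := this
        obtain ⟨S₁, rfl⟩ := Multiset.exists_cons_of_mem hG
        rw [Multiset.count_cons_of_ne hGF.ne'] at hrk
        obtain ⟨S₂, hS₂⟩ := Multiset.le_iff_exists_add.1
          (Multiset.le_count_iff_replicate_le.1 (le_refl (S₁.count F)))
        set c := S₁.count F
        have hlt := rk_lt_rk (hR G (hS G hG)) (hR F (hS F hF)) hGF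
        have key := ih (F ::ₘ S₁) (by
          intro H hH
          rcases Multiset.mem_cons.1 hH with rfl | hH
          · exact hS _ hF
          · exact hS _ (Multiset.mem_cons_of_mem hH)) (by
          simp only [Multiset.card_cons, Multiset.map_cons, Multiset.sum_cons] at hn ⊢
          omega)
        rw [Multiset.card_cons] at key ⊢
        convert key using 1
        rw [hS₂]
        simp only [Multiset.map_cons, Multiset.map_add, Multiset.map_replicate,
          Multiset.prod_cons, Multiset.prod_add, Multiset.prod_replicate]
        rw [← mul_assoc (hClass P x a G), hx.hClass_mul_pow hP (hR G (hS G hG)) (hR F (hS F hF))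
          hGF (by omega), pow_succ']
        ring
      · push Not at hcount
        obtain ⟨F, hF, hrk⟩ := hcount
        obtain ⟨S₂, hS₂⟩ := Multiset.le_iff_exists_add.1
          (Multiset.le_count_iff_replicate_le.1 (le_refl (S.count F)))
        rw [hS₂]
        simp only [Multiset.map_add, Multiset.map_replicate, Multiset.prod_add,
          Multiset.prod_replicate]
        rw [← mul_assoc, hz F (hS F hF) _ hrk, zero_mul]
        exact zero_mem _
    · push Not at hchain
      obtain ⟨F, hF, G, hG, hFG, hGF⟩ := hchain
      obtain ⟨S₁, rfl⟩ := Multiset.exists_cons_of_mem hF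
      have hne : G ≠ F := fun h => hGF h.le
      obtain ⟨S₂, rfl⟩ := Multiset.exists_cons_of_mem
        ((Multiset.mem_cons.1 hG).resolve_left hne)
      have hFR := hS F hF
      have hGR := hS G hG
      have hFE := (hR F hFR).subset_ground
      have hGE := (hR G hGR).subset_ground
      have hJf : M.IsFlat (join M F G) := M.isFlat_closure _
      have hJR : join M F G ∈ R := hR' F hFR _ hJf (left_subset_join hFE)
      have hFJ : rk M F < rk M (join M F G) := rk_lt_rk (hR F hFR) hJf
        ⟨left_subset_join hFE, fun h => hGF ((right_subset_join hGE).trans h)⟩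
      have hGJ : rk M G < rk M (join M F G) := rk_lt_rk (hR G hGR) hJf
        ⟨right_subset_join hGE, fun h => hFG ((left_subset_join hFE).trans h)⟩
      have hrel := hx.hClass_sub_join_mul hP hFE hGE
      have hS₂ : ∀ H ∈ S₂, H ∈ R := fun H hH =>
        hS H (Multiset.mem_cons_of_mem (Multiset.mem_cons_of_mem hH))
      have step : ∀ B ∈ R, ∀ C ∈ R, rk M F + rk M G < rk M B + rk M C →
          z * (hClass P x a B * (hClass P x a C * (S₂.map (hClass P x a)).prod)) ∈
            reducedSpan M (hClass P x a) z n₀ R (F ::ₘ G ::ₘ S₂).card := by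
        intro B hB C hC hlt
        have := ih (B ::ₘ C ::ₘ S₂) (by
          intro H hH
          simp only [Multiset.mem_cons] at hH
          rcases hH with rfl | rfl | hH
          exacts [hB, hC, hS₂ H hH]) (by
          simp only [Multiset.card_cons, Multiset.map_cons, Multiset.sum_cons] at hn ⊢
          omega)
        simpa only [Multiset.card_cons, Multiset.map_cons, Multiset.prod_cons] using this
      have h1 := step F hFR _ hJR (by omega)
      have h2 := step G hGR _ hJR (by omega)
      have h3 := step _ hJR _ hJR (by omega)
      have := sub_mem (add_mem h1 h2) h3
      convert this using 1
      simp only [Multiset.map_cons, Multiset.prod_cons]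
      linear_combination z * (S₂.map (hClass P x a)).prod * hrel

/-- Straighten above F: a multiset reduced over rank rk F has fewer than rk E - rk F members, so the
span is zero. -/
theorem IsChowFamily.x_mul_prod_hClass_eq_zero [M.Finite] (hx : IsChowFamily M P x a)
    (hP : IsOrderFilter M P) {F : Set α} (hF : F ∈ P) {S : Multiset (Set α)}
    (hS : ∀ G ∈ S, M.IsFlat G ∧ F ⊂ G) (hc : rk M M.E ≤ S.card + rk M F) :
    x F * (S.map (hClass P x a)).prod = 0 := by
  have h := hx.mul_prod_mem_reducedSpan hP (z := x F) (n₀ := rk M F)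
    (R := {G | M.IsFlat G ∧ F ⊂ G}) (fun G hG => hG.1)
    (fun G hG H hH h => ⟨hH, hG.2.trans_subset h⟩)
    (fun G hG c hc => hx.x_mul_pow hP hF hG.1 hG.2 (by omega)) _ S hS
    (Nat.lt_add_left _ (Nat.lt_succ_self _))
  suffices hbot : reducedSpan M (hClass P x a) (x F) (rk M F)
      {G | M.IsFlat G ∧ F ⊂ G} S.card = ⊥ by
    rwa [hbot, Submodule.mem_bot] at h
  rw [reducedSpan, Submodule.span_eq_bot]
  rintro b ⟨T, hT, hTr, hTc, rfl⟩
  have hFE : rk M F < rk M M.E := rk_lt_rk (hP.isFlat F hF) M.ground_isFlat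
    ((hP.isFlat F hF).subset_ground.ssubset_of_ne (hP.ne_ground F hF))
  have := hTr.card_add_lt _ le_rfl (F := M.E)
    (fun G hG => (hT G hG).1.subset_ground) hFE
  omega

end Straightening

/-! ### The dragon Hall–Rado functional and Möbius inversion over flats. -/

section HallRado

open Classical MvPolynomial

variable {α : Type*} (M : Matroid α)

/-- The dragon Hall–Rado condition: every nonempty subfamily with `k` members has a union of rank
at least `k + 1`. -/
def IsHallRado (S : Multiset (Set α)) : Prop :=
  ∀ J ≤ S, J ≠ 0 → J.card + 1 ≤ rk M J.sup

variable {M}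

theorem sup_cons_eq_union (F : Set α) (S : Multiset (Set α)) : (F ::ₘ S).sup = F ∪ S.sup :=
  Multiset.sup_cons F S

theorem isHallRado_cons {F : Set α} {S : Multiset (Set α)} :
    IsHallRado M (F ::ₘ S) ↔ IsHallRado M S ∧ ∀ J ≤ S, J.card + 2 ≤ rk M (F ∪ J.sup) := by
  constructor
  · refine fun h => ⟨fun J hJ => h J (hJ.trans (Multiset.le_cons_self S F)), fun J hJ => ?_⟩
    have := h (F ::ₘ J) (Multiset.cons_le_cons F hJ) (Multiset.cons_ne_zero)
    rwa [Multiset.card_cons, sup_cons_eq_union] at this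
  · intro h J hJ h0
    by_cases hF : F ∈ J
    · obtain ⟨J, rfl⟩ := Multiset.exists_cons_of_mem hF
      have := h.2 J ((Multiset.cons_le_cons_iff F).1 hJ)
      rwa [Multiset.card_cons, sup_cons_eq_union]
    · exact h.1 J ((Multiset.le_cons_of_notMem hF).1 hJ) h0

variable [M.Finite]

/-- All four conditions share the requirement `c` on the join and the condition on S; beyond these
they require `a F` and `a G`, nothing, `a F`, and `a G`. The identity becomes (1 - [a F])(1 - [a G])
= 0. -/
theorem isHallRado_join {F G : Set α} {S : Multiset (Set α)} :
    (if IsHallRado M (F ::ₘ G ::ₘ S) then (1 : ℤ) else 0) +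
      (if IsHallRado M (join M F G ::ₘ join M F G ::ₘ S) then 1 else 0) =
    (if IsHallRado M (F ::ₘ join M F G ::ₘ S) then 1 else 0) +
      (if IsHallRado M (G ::ₘ join M F G ::ₘ S) then 1 else 0) := by
  set a : Set α → Prop := fun F => ∀ J ≤ S, J.card + 2 ≤ rk M (F ∪ J.sup) with ha
  set c : Prop := ∀ J ≤ S, J.card + 3 ≤ rk M (F ∪ G ∪ J.sup) with hc
  have hpair : ∀ B C : Set α, (∀ X, rk M (B ∪ C ∪ X) = rk M (F ∪ G ∪ X)) →
      (IsHallRado M (B ::ₘ C ::ₘ S) ↔ IsHallRado M S ∧ a B ∧ a C ∧ c) := by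
    intro B C hBC
    rw [isHallRado_cons, isHallRado_cons, and_assoc]
    refine and_congr_right fun hS => ?_
    constructor
    · rintro ⟨hC, hB⟩
      refine ⟨fun J hJ => hB J (hJ.trans (Multiset.le_cons_self S C)), hC, fun J hJ => ?_⟩
      have := hB (C ::ₘ J) (Multiset.cons_le_cons C hJ)
      rw [Multiset.card_cons, sup_cons_eq_union, ← Set.union_assoc, hBC] at this
      omega
    · rintro ⟨hB, hC, h⟩
      refine ⟨hC, fun J hJ => ?_⟩
      by_cases hCJ : C ∈ J
      · obtain ⟨J, rfl⟩ := Multiset.exists_cons_of_mem hCJ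
        have := h J ((Multiset.cons_le_cons_iff C).1 hJ)
        rw [Multiset.card_cons, sup_cons_eq_union, ← Set.union_assoc, hBC]
        omega
      · exact hB J ((Multiset.le_cons_of_notMem hCJ).1 hJ)
  have hcl : ∀ B X : Set α, B ⊆ F ∪ G → rk M (B ∪ join M F G ∪ X) = rk M (F ∪ G ∪ X) := by
    intro B X hB
    rw [Set.union_comm B, Set.union_assoc, rk_closure_union, ← Set.union_assoc,
      Set.union_eq_self_of_subset_right hB]
  have hU : c → a (join M F G) := by
    intro h J hJ
    have := h J hJ
    rw [rk_closure_union]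
    omega
  have hUU : ∀ X, rk M (join M F G ∪ join M F G ∪ X) = rk M (F ∪ G ∪ X) := by
    intro X
    rw [Set.union_self, rk_closure_union]
  -- If J₁ violates `a F` and J₂ violates `a G`, submodularity for F ∪ J₁ and G ∪ J₂ contradicts `c`
  -- at J₁ ∪ J₂ together with Hall–Rado at J₁ ∩ J₂.
  have hor : IsHallRado M S → c → a F ∨ a G := by
    intro hS h
    by_contra! hcon
    simp only [ha, not_forall, not_le] at hcon
    obtain ⟨⟨J₁, hJ₁, h₁⟩, J₂, hJ₂, h₂⟩ := hcon
    have hsub := rk_inter_add_rk_union_le M (F ∪ J₁.sup) (G ∪ J₂.sup)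
    have hun := h (J₁ ∪ J₂) (Multiset.union_le hJ₁ hJ₂)
    have heq : F ∪ G ∪ (J₁ ∪ J₂).sup = F ∪ J₁.sup ∪ (G ∪ J₂.sup) := by
      have : (J₁ ∪ J₂).sup = J₁.sup ∪ J₂.sup := Multiset.sup_union _ _
      rw [this, Set.union_union_union_comm]
    have hcard : (J₁ ∪ J₂).card + (J₁ ∩ J₂).card = J₁.card + J₂.card := by
      rw [← Multiset.card_add, Multiset.union_add_inter, Multiset.card_add]
    have hinter : (J₁ ∩ J₂).card ≤ rk M ((F ∪ J₁.sup) ∩ (G ∪ J₂.sup)) := by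
      by_cases h0 : J₁ ∩ J₂ = 0
      · simp [h0]
      · have h3 := hS (J₁ ∩ J₂) (Multiset.inter_le_left.trans hJ₁) h0
        have h4 : (J₁ ∩ J₂).sup ⊆ (F ∪ J₁.sup) ∩ (G ∪ J₂.sup) := Set.subset_inter
          ((Multiset.sup_mono (Multiset.subset_of_le Multiset.inter_le_left)).trans
            Set.subset_union_right)
          ((Multiset.sup_mono (Multiset.subset_of_le Multiset.inter_le_right)).trans
            Set.subset_union_right)
        have h5 := rk_mono M h4
        omega
    rw [heq] at hun
    omega
  rw [if_congr (hpair F G fun _ => rfl) rfl rfl, if_congr (hpair _ _ hUU) rfl rfl,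
    if_congr (hpair _ _ fun X => hcl F X Set.subset_union_left) rfl rfl,
    if_congr (hpair _ _ fun X => hcl G X Set.subset_union_right) rfl rfl]
  clear hpair hcl hUU
  clear_value a c
  clear ha hc
  by_cases hS : IsHallRado M S <;> by_cases hcc : c <;> by_cases haF : a F <;>
    by_cases haG : a G <;> simp_all

variable (M)

/-- The functional on polynomials in variables indexed by sets that takes a monomial to `1` if it
satisfies the dragon Hall–Rado condition and to `0` otherwise. -/
noncomputable def hallDeg : MvPolynomial (Set α) ℤ →ₗ[ℤ] ℤ :=
  (basisMonomials (Set α) ℤ).constr ℤ fun m => if IsHallRado M m.toMultiset then 1 else 0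

theorem prod_map_X (S : Multiset (Set α)) :
    (S.map (X : Set α → MvPolynomial (Set α) ℤ)).prod = monomial (Multiset.toFinsupp S) 1 := by
  induction S using Multiset.induction with
  | empty => simp
  | cons F S ih =>
    rw [Multiset.map_cons, Multiset.prod_cons, ih, X, monomial_mul, ← Multiset.singleton_add,
      map_add, Multiset.toFinsupp_singleton, one_mul]

omit [M.Finite] in
theorem hallDeg_prod (S : Multiset (Set α)) :
    hallDeg M (S.map X).prod = if IsHallRado M S then 1 else 0 := by
  have h := (basisMonomials (Set α) ℤ).constr_basis ℤ
    (fun m => if IsHallRado M m.toMultiset then (1 : ℤ) else 0) (Multiset.toFinsupp S)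
  rw [coe_basisMonomials, Multiset.toFinsupp_toMultiset] at h
  rwa [prod_map_X]

/-- The ideal of polynomials all of whose multiples are killed by `hallDeg`. -/
def hallIdeal : Ideal (MvPolynomial (Set α) ℤ) where
  carrier := {p | ∀ q, hallDeg M (q * p) = 0}
  add_mem' hp hp' q := by rw [mul_add, map_add, hp q, hp' q, add_zero]
  zero_mem' q := by rw [mul_zero, map_zero]
  smul_mem' c p hp q := by rw [smul_eq_mul, ← mul_assoc, hp]

omit [M.Finite] in
theorem mem_hallIdeal_iff {p : MvPolynomial (Set α) ℤ} :
    p ∈ hallIdeal M ↔ ∀ S : Multiset (Set α), hallDeg M ((S.map X).prod * p) = 0 := by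
  refine ⟨fun h S => h _, fun h q => ?_⟩
  have : (hallDeg M).comp (LinearMap.mulRight ℤ p) = 0 := by
    refine (basisMonomials (Set α) ℤ).ext fun m => ?_
    have := h m.toMultiset
    rw [prod_map_X, Finsupp.toMultiset_toFinsupp] at this
    simpa using this
  exact LinearMap.congr_fun this q

omit [M.Finite] in
theorem X_mem_hallIdeal {F : Set α} (hF : rk M F ≤ 1) : X F ∈ hallIdeal M := by
  rw [mem_hallIdeal_iff]
  intro S
  have h : (S.map (X : Set α → MvPolynomial (Set α) ℤ)).prod * X F =
      ((F ::ₘ S).map X).prod := by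
    rw [Multiset.map_cons, Multiset.prod_cons, mul_comm]
  rw [h, hallDeg_prod, if_neg]
  intro hcon
  have := hcon {F} (by simp) (by simp)
  simp only [Multiset.card_singleton, Multiset.sup_singleton] at this
  omega

theorem X_sub_join_mul_mem_hallIdeal (F G : Set α) :
    (X F - X (join M F G)) * (X G - X (join M F G)) ∈ hallIdeal M := by
  rw [mem_hallIdeal_iff]
  intro S
  set p := (S.map (X : Set α → MvPolynomial (Set α) ℤ)).prod with hp
  have h : ∀ B C : Set α, hallDeg M (X B * (X C * p)) =
      if IsHallRado M (B ::ₘ C ::ₘ S) then 1 else 0 := by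
    intro B C
    rw [← hallDeg_prod, Multiset.map_cons, Multiset.map_cons, Multiset.prod_cons,
      Multiset.prod_cons]
  set J := join M F G with hJ
  have hexp : p * ((X F - X J) * (X G - X J)) =
      (X F * (X G * p) + X J * (X J * p)) - (X F * (X J * p) + X G * (X J * p)) := by ring
  rw [hexp, map_sub, map_add, map_add, h, h, h, h, isHallRado_join, sub_self]

theorem finite_flats : {F | M.IsFlat F ∧ F.Nonempty}.Finite :=
  M.ground_finite.finite_subsets.subset fun _ hF => hF.1.subset_ground

/-- The nonempty flats of a finite matroid. -/
noncomputable def flats : Finset (Set α) := (finite_flats M).toFinset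

variable {M}

theorem mem_flats {F : Set α} : F ∈ flats M ↔ M.IsFlat F ∧ F.Nonempty := by
  simp [flats]

theorem ncard_ground_diff_lt {F G : Set α} (hG : G ⊆ M.E) (h : F ⊂ G) :
    (M.E \ G).ncard < (M.E \ F).ncard := by
  refine Set.ncard_lt_ncard ⟨Set.sdiff_subset_sdiff_right h.1, fun h' => ?_⟩ M.ground_finite.sdiff
  obtain ⟨i, hiG, hiF⟩ := Set.exists_of_ssubset h
  exact (h' ⟨hG hiG, hiF⟩).2 hiG

variable (M) in
/-- The Möbius inversion of a function on the nonempty flats. -/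
noncomputable def flatInversion {A : Type*} [AddCommGroup A] (g : Set α → A) (F : Set α) : A :=
  g F - ∑ G : {G // G ∈ (flats M).filter (F ⊂ ·)}, flatInversion g G.1
termination_by (M.E \ F).ncard
decreasing_by
  have hG := Finset.mem_filter.1 G.2
  exact ncard_ground_diff_lt (mem_flats.1 hG.1).1.subset_ground hG.2

theorem sum_flatInversion {A : Type*} [AddCommGroup A] (g : Set α → A) {F : Set α}
    (hF : F ∈ flats M) : ∑ G ∈ flats M with F ⊆ G, flatInversion M g G = g F := by
  have h : (flats M).filter (F ⊆ ·) = insert F ((flats M).filter (F ⊂ ·)) := by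
    ext G
    simp only [Finset.mem_filter, Finset.mem_insert]
    constructor
    · rintro ⟨hG, hFG⟩
      rcases hFG.eq_or_ssubset with h | h
      exacts [Or.inl h.symm, Or.inr ⟨hG, h⟩]
    · rintro (rfl | ⟨hG, hFG⟩)
      exacts [⟨hF, subset_rfl⟩, ⟨hG, hFG.1⟩]
  rw [h, Finset.sum_insert (by simp), flatInversion,
    Finset.sum_coe_sort _ (flatInversion M g), sub_add_cancel]

end HallRado

/-! ### A Chow family in the quotient by the Hall–Rado ideal. -/

section Degree

open Classical MvPolynomial

variable {α : Type*} {M : Matroid α} [M.Finite]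

variable (M) in
/-- The classes `x_F` in terms of the variables `X G = -∑ x_F`, where the sum is over the flats `F`
that contain `G`. -/
noncomputable abbrev flatVar : Set α → MvPolynomial (Set α) ℤ :=
  flatInversion M fun F => -X F

/-- With J the join, (X_J - X_F)(X_J - X_G) expands into x_B x_C with F ⊆ B, G ⊆ C, neither
containing J. All these pairs are incomparable, and all except (F, G) are covered by induction on
the size of the complements. -/
theorem flatVar_mul_flatVar_mem_hallIdeal (n : ℕ) : ∀ F G : Set α, F ∈ flats M → G ∈ flats M →
    ¬ F ⊆ G → ¬ G ⊆ F → (M.E \ F).ncard + (M.E \ G).ncard ≤ n →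
    flatVar M F * flatVar M G ∈ hallIdeal M := by
  induction n with
  | zero =>
    intro F G hF hG hFG hGF hn
    have h := ncard_ground_diff_lt (mem_flats.1 hG).1.subset_ground
      (F := F ∩ G) ⟨Set.inter_subset_right, fun h => hGF (h.trans Set.inter_subset_left)⟩
    have h1 : M.E \ F = ∅ := by
      rw [← Set.ncard_eq_zero M.ground_finite.sdiff]
      omega
    exact absurd ((mem_flats.1 hG).1.subset_ground.trans (Set.sdiff_eq_empty.1 h1)) hGF
  | succ n ih =>
    intro F G hF hG hFG hGF hn
    have hFE := (mem_flats.1 hF).1.subset_ground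
    have hGE := (mem_flats.1 hG).1.subset_ground
    have hJ : join M F G ∈ flats M :=
      mem_flats.2 ⟨M.isFlat_closure _, (mem_flats.1 hF).2.mono (left_subset_join hFE)⟩
    have hsum : ∀ B ∈ flats M, B ⊆ join M F G →
        X (join M F G) - X B = ∑ C ∈ flats M with B ⊆ C ∧ ¬ join M F G ⊆ C, flatVar M C := by
      intro B hB hBJ
      have h1 := sum_flatInversion (fun F => (-X F : MvPolynomial (Set α) ℤ)) hB
      have h2 := sum_flatInversion (fun F => (-X F : MvPolynomial (Set α) ℤ)) hJ
      rw [← Finset.sum_filter_add_sum_filter_not _ (join M F G ⊆ ·), Finset.filter_filter,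
        Finset.filter_filter] at h1
      have h3 : (flats M).filter (fun C => B ⊆ C ∧ join M F G ⊆ C) =
          (flats M).filter (fun C => join M F G ⊆ C) :=
        Finset.filter_congr fun C _ => ⟨fun h => h.2, fun h => ⟨hBJ.trans h, h⟩⟩
      rw [h3, h2] at h1
      linear_combination -h1
    have hmem := X_sub_join_mul_mem_hallIdeal M F G
    rw [← neg_mul_neg, neg_sub, neg_sub, hsum F hF (left_subset_join hFE),
      hsum G hG (right_subset_join hGE), Finset.sum_mul_sum] at hmem
    set s := (flats M).filter (fun C => F ⊆ C ∧ ¬ join M F G ⊆ C) with hs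
    set t := (flats M).filter (fun C => G ⊆ C ∧ ¬ join M F G ⊆ C) with ht
    rw [← Finset.sum_product'] at hmem
    have hFs : (F, G) ∈ s ×ˢ t := by
      rw [Finset.mem_product, hs, ht, Finset.mem_filter, Finset.mem_filter]
      exact ⟨⟨hF, subset_rfl, fun h => hGF ((right_subset_join hGE).trans h)⟩, hG, subset_rfl,
        fun h => hFG ((left_subset_join hFE).trans h)⟩
    rw [← Finset.add_sum_erase _ _ hFs] at hmem
    refine (Ideal.add_mem_iff_left _ (Ideal.sum_mem _ fun BC hBC => ?_)).1 hmem
    obtain ⟨B, C⟩ := BC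
    rw [Finset.mem_erase, Finset.mem_product, hs, ht, Finset.mem_filter, Finset.mem_filter] at hBC
    obtain ⟨hne, ⟨hB, hFB, hJB⟩, hC, hGC, hJC⟩ := hBC
    rw [join_subset_iff (mem_flats.1 hB).1 hFE hGE] at hJB
    rw [join_subset_iff (mem_flats.1 hC).1 hFE hGE] at hJC
    refine ih B C hB hC (fun h => hJC ⟨hFB.trans h, hGC⟩) (fun h => hJB ⟨hFB, hGC.trans h⟩) ?_
    have hBE := (mem_flats.1 hB).1.subset_ground
    have hCE := (mem_flats.1 hC).1.subset_ground
    have h1 : F ⊂ B → (M.E \ B).ncard < (M.E \ F).ncard := ncard_ground_diff_lt hBE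
    have h2 : G ⊂ C → (M.E \ C).ncard < (M.E \ G).ncard := ncard_ground_diff_lt hCE
    rcases hFB.eq_or_ssubset with rfl | hFB
    · rcases hGC.eq_or_ssubset with rfl | hGC
      · exact absurd rfl hne
      · have := h2 hGC
        omega
    · rcases hGC.eq_or_ssubset with rfl | hGC
      · have := h1 hFB
        omega
      · have := h1 hFB
        have := h2 hGC
        omega

/-- Incomparable products vanish for all nonempty flats, with x_E = -a. For the given filter, x_i
becomes the sum of x_B over flats B containing i outside P ∪ {E}; such a B contains no member of P,
which yields the other relations. -/
theorem isChowFamily_flatVar {P : Finset (Set α)} (hP : IsOrderFilter M P) [M.Loopless]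
    (hE : M.E.Nonempty) :
    IsChowFamily M P (fun F => Ideal.Quotient.mk (hallIdeal M) (flatVar M F))
      (Ideal.Quotient.mk (hallIdeal M) (X M.E)) := by
  set x := fun F => Ideal.Quotient.mk (hallIdeal M) (flatVar M F) with hx
  set a := Ideal.Quotient.mk (hallIdeal M) (X M.E) with ha
  have hPf : ∀ F ∈ P, F ∈ flats M := fun F hF => mem_flats.2 ⟨hP.isFlat F hF, hP.nonempty F hF⟩
  have hinc : ∀ F ∈ flats M, ∀ G ∈ flats M, ¬ F ⊆ G → ¬ G ⊆ F → x F * x G = 0 := by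
    intro F hF G hG hFG hGF
    rw [hx, ← map_mul, Ideal.Quotient.eq_zero_iff_mem]
    exact flatVar_mul_flatVar_mem_hallIdeal _ F G hF hG hFG hGF le_rfl
  have hEf : M.E ∈ flats M := mem_flats.2 ⟨M.ground_isFlat, hE⟩
  have hxE : x M.E = - a := by
    have h := sum_flatInversion (fun F => (-X F : MvPolynomial (Set α) ℤ)) hEf
    have hfil : (flats M).filter (M.E ⊆ ·) = {M.E} := by
      ext B
      simp only [Finset.mem_filter, Finset.mem_singleton]
      exact ⟨fun h => (mem_flats.1 h.1).1.subset_ground.antisymm h.2,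
        by rintro rfl; exact ⟨hEf, subset_rfl⟩⟩
    rw [hfil, Finset.sum_singleton] at h
    rw [hx, ha, ← map_neg, ← h]
  have hsing : ∀ i ∈ M.E, hClass P x a {i} =
      ∑ B ∈ flats M with i ∈ B ∧ B ∉ insert M.E P, x B := by
    intro i hi
    have hcl : M.closure {i} ∈ flats M :=
      mem_flats.2 ⟨M.isFlat_closure _, ⟨i, M.mem_closure_self i hi⟩⟩
    have h := sum_flatInversion (fun F => (-X F : MvPolynomial (Set α) ℤ)) hcl
    -- A single set passes Hall–Rado only if its rank is at least 2. Hence the x_B over all flats B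
    -- containing i sum to zero.
    have hmem : X (M.closure {i}) ∈ hallIdeal M :=
      X_mem_hallIdeal M ((rk_closure M {i}).trans_le (rk_singleton_le M i))
    replace h := congrArg (Ideal.Quotient.mk (hallIdeal M)) h
    rw [map_neg, Ideal.Quotient.eq_zero_iff_mem.2 hmem, neg_zero, map_sum] at h
    have hfil : (flats M).filter (M.closure {i} ⊆ ·) = (flats M).filter (i ∈ ·) := by
      refine Finset.filter_congr fun B hB => ?_
      have hBf := (mem_flats.1 hB).1
      exact ⟨fun h => h (M.mem_closure_self i hi), fun h => by
        simpa [hBf.closure] using M.closure_subset_closure (Set.singleton_subset_iff.2 h)⟩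
    rw [hfil, ← Finset.sum_filter_add_sum_filter_not _ (· ∈ insert M.E P), Finset.filter_filter,
      Finset.filter_filter] at h
    have hfil' : (flats M).filter (fun B => i ∈ B ∧ B ∈ insert M.E P) =
        insert M.E (P.filter ({i} ⊆ ·)) := by
      ext B
      simp only [Finset.mem_filter, Finset.mem_insert, Set.singleton_subset_iff]
      constructor
      · rintro ⟨-, hiB, rfl | hB⟩
        exacts [Or.inl rfl, Or.inr ⟨hB, hiB⟩]
      · rintro (rfl | ⟨hB, hiB⟩)
        exacts [⟨hEf, hi, Or.inl rfl⟩, ⟨hPf B hB, hiB, Or.inr hB⟩]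
    rw [hfil', Finset.sum_insert (fun h => hP.ne_ground _ (Finset.mem_filter.1 h).1 rfl)] at h
    change x M.E + ∑ B ∈ P with {i} ⊆ B, x B + ∑ B ∈ flats M with i ∈ B ∧ B ∉ insert M.E P, x B = 0
      at h
    rw [hxE] at h
    rw [hClass]
    linear_combination -h
  have hnot : ∀ F ∈ P, ∀ B ∈ flats M, B ∉ insert M.E P → ¬ F ⊆ B := fun F hF B hB hBP h =>
    hBP (hP.mem_of_subset' (Finset.mem_insert_of_mem hF) (mem_flats.1 hB).1 h)
  refine ⟨fun F hF G hG => hinc F (hPf F hF) G (hPf G hG), fun F hF i hi hiF => ?_,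
    fun I hI hcl => ?_⟩
  · rw [hsing i hi, Finset.mul_sum]
    refine Finset.sum_eq_zero fun B hB => ?_
    rw [Finset.mem_filter] at hB
    exact hinc F (hPf F hF) B hB.1 (hnot F hF B hB.1 hB.2.2) fun h => hiF (h hB.2.1)
  -- The empty set is a flat, neither in P nor equal to E, so the closure relation never concerns
  -- the empty product.
  · have hne : I.Nonempty := by
      rw [Finset.nonempty_iff_ne_empty]
      rintro rfl
      have h : M.closure ((∅ : Finset α) : Set α) = ∅ := by
        rw [Finset.coe_empty]
        exact isFlat_empty.closure
      rw [h] at hcl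
      rcases hcl with hcl | hcl
      · exact (hP.nonempty _ hcl).ne_empty rfl
      · exact hE.ne_empty hcl.symm
    have h0 : ∀ i ∈ I, hClass P x a {i} =
        0 + ∑ B ∈ flats M with i ∈ B ∧ B ∉ insert M.E P, x B := fun i hi => by
      rw [hsing i (hI.subset_ground hi), zero_add]
    rw [Finset.prod_congr rfl h0]
    obtain ⟨i₀, hi₀⟩ := hne
    refine prod_add_sum_eq_zero I _ _ _ (Finset.prod_eq_zero hi₀ rfl) ?_ ?_ ?_ ?_
    · exact fun i _ B hB => (Finset.mem_filter.1 hB).2.1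
    · intro j hj B hB
      rw [Finset.mem_filter] at hB
      by_contra! hcon
      have hsub : M.closure (I : Set α) ⊆ B := by
        rw [← (mem_flats.1 hB.1).1.closure]
        exact M.closure_subset_closure hcon
      exact hB.2.2 (hP.mem_of_subset' (Finset.mem_insert.2 hcl.symm) (mem_flats.1 hB.1).1 hsub)
    · exact fun _ _ _ _ _ _ _ => mul_zero _
    · exact fun i _ j _ B hB C hC => hinc B (Finset.mem_filter.1 hB).1 C (Finset.mem_filter.1 hC).1

end Degree

/-! ### The Chow ring as the universal Chow family, and its degree map. -/

section ChowFamily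

open Classical

variable {α : Type*} (M : Matroid α) (P : Finset (Set α))

/-- The class of `x_F` in the Chow ring, or `0` if `F` is not in `P`. -/
noncomputable def chowVar (F : Set α) : ChowRing M P :=
  if h : F ∈ P then Ideal.Quotient.mk _ (xF M P ⟨F, h⟩) else 0

/-- The common class of the linear forms in the Chow ring. -/
noncomputable def chowLin (e : {i // i ∈ M.E}) : ChowRing M P :=
  Ideal.Quotient.mk _ (linForm M P e)

variable {M P}

theorem mk_linForm (e i : {i // i ∈ M.E}) :
    Ideal.Quotient.mk (relIdeal M P) (linForm M P i) = chowLin M P e := by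
  by_cases h : i = e
  · rw [h, chowLin]
  · rw [chowLin, Ideal.Quotient.mk_eq_mk_iff_sub_mem]
    exact Ideal.mem_sup_right (Ideal.subset_span ⟨i, e, h, rfl⟩)

theorem sum_chowVar (p : Set α → Prop) :
    ∑ F : {F // F ∈ P} with p F.1, Ideal.Quotient.mk (relIdeal M P) (xF M P F) =
      ∑ F ∈ P with p F, chowVar M P F := by
  rw [Finset.sum_filter, Finset.sum_filter, ← Finset.sum_coe_sort P]
  refine Finset.sum_congr rfl fun F _ => ?_
  rw [chowVar, dif_pos F.2]

theorem hClass_chowVar_singleton (e i : {i // i ∈ M.E}) :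
    hClass P (chowVar M P) (chowLin M P e) {i.1} = Ideal.Quotient.mk (relIdeal M P) (xE M P i) := by
  rw [hClass, ← mk_linForm e i, linForm, map_add, map_sum, ← sum_chowVar]
  simp only [Set.singleton_subset_iff]
  rw [add_sub_assoc, add_eq_left, sub_eq_zero]

theorem isChowFamily_chowVar (e : {i // i ∈ M.E}) :
    IsChowFamily M P (chowVar M P) (chowLin M P e) where
  incomparable F hF G hG hFG hGF := by
    rw [chowVar, chowVar, dif_pos hF, dif_pos hG, ← map_mul, Ideal.Quotient.eq_zero_iff_mem]
    exact Ideal.mem_sup_left (Ideal.mem_sup_left (Ideal.mem_sup_left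
      (Ideal.subset_span ⟨⟨F, hF⟩, ⟨G, hG⟩, hFG, hGF, rfl⟩)))
  complement F hF i hi hiF := by
    rw [hClass_chowVar_singleton e ⟨i, hi⟩, chowVar, dif_pos hF, mul_comm, ← map_mul,
      Ideal.Quotient.eq_zero_iff_mem]
    exact Ideal.mem_sup_left (Ideal.mem_sup_left (Ideal.mem_sup_right
      (Ideal.subset_span ⟨⟨i, hi⟩, ⟨F, hF⟩, hiF, rfl⟩)))
  closure I hI hcl := by
    have h : ∏ i ∈ I, hClass P (chowVar M P) (chowLin M P e) {i} =
        Ideal.Quotient.mk (relIdeal M P) (∏ i ∈ I.subtype (· ∈ M.E), xE M P i) := by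
      rw [map_prod, ← Finset.prod_subtype_of_mem _ fun i hi => hI.subset_ground hi]
      exact Finset.prod_congr rfl fun i _ => hClass_chowVar_singleton e i
    have himg : Subtype.val '' ((I.subtype (· ∈ M.E) : Finset {i // i ∈ M.E}) :
        Set {i // i ∈ M.E}) = (I : Set α) := by
      ext i
      simp only [Set.mem_image, Finset.mem_coe, Finset.mem_subtype, Subtype.exists,
        exists_and_left, exists_prop, exists_eq_right_right, and_iff_left_iff_imp]
      exact fun hi => hI.subset_ground hi
    rw [h, Ideal.Quotient.eq_zero_iff_mem]
    exact Ideal.mem_sup_left (Ideal.mem_sup_right (Ideal.subset_span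
      ⟨I.subtype (· ∈ M.E), by rwa [himg], by rwa [himg], rfl⟩))

theorem IsChowFamily.exists_ringHom {A : Type*} [CommRing A] {x : Set α → A} {a : A}
    (hx : IsChowFamily M P x a) (e : {i // i ∈ M.E}) :
    ∃ φ : ChowRing M P →+* A, φ (chowLin M P e) = a := by
  set ψ : PolyRing M P →+* A := (MvPolynomial.aeval
    (Sum.elim (fun i => hClass P x a {i.1}) fun F => x F.1) : PolyRing M P →ₐ[ℤ] A).toRingHom
  have hE : ∀ i, ψ (xE M P i) = hClass P x a {i.1} := fun i => by simp [ψ, xE]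
  have hF : ∀ F, ψ (xF M P F) = x F.1 := fun F => by simp [ψ, xF]
  have hlin : ∀ i, ψ (linForm M P i) = a := by
    intro i
    rw [linForm, map_add, hE, map_sum, hClass, sub_add_eq_add_sub, add_sub_assoc, add_eq_left,
      sub_eq_zero, Finset.sum_filter, Finset.sum_filter, ← Finset.sum_coe_sort P]
    refine Finset.sum_congr rfl fun F _ => ?_
    rw [hF]
    simp
  have hrel : relIdeal M P ≤ RingHom.ker ψ := by
    refine sup_le (sup_le (sup_le ?_ ?_) ?_) ?_ <;> rw [Ideal.span_le]
    · rintro _ ⟨F, G, hFG, hGF, rfl⟩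
      rw [SetLike.mem_coe, RingHom.mem_ker, map_mul, hF, hF]
      exact hx.incomparable F F.2 G G.2 hFG hGF
    · rintro _ ⟨i, F, hiF, rfl⟩
      rw [SetLike.mem_coe, RingHom.mem_ker, map_mul, hF, hE, mul_comm]
      exact hx.complement F F.2 i i.2 hiF
    · rintro _ ⟨I, hI, hcl, rfl⟩
      have himg : ((I.map (Function.Embedding.subtype _) : Finset α) : Set α) =
          Subtype.val '' (I : Set {i // i ∈ M.E}) := by simp
      have := hx.closure (I.map (Function.Embedding.subtype _)) (by rwa [himg]) (by rwa [himg])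
      rw [SetLike.mem_coe, RingHom.mem_ker, map_prod, ← this, Finset.prod_map]
      exact Finset.prod_congr rfl fun i _ => hE i
    · rintro _ ⟨i, j, -, rfl⟩
      rw [SetLike.mem_coe, RingHom.mem_ker, map_sub, hlin, hlin, sub_self]
  exact ⟨Ideal.Quotient.lift _ ψ hrel, hlin e⟩

/-- The degree map of the Chow ring. -/
theorem exists_degree [M.Finite] [M.Loopless] (hP : IsOrderFilter M P) (e : {i // i ∈ M.E})
    {r : ℕ} (hr : r < rk M M.E) :
    ∃ D : ChowRing M P →ₗ[ℤ] ℤ, D (chowLin M P e ^ r) = 1 := by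
  obtain ⟨φ, hφ⟩ := (isChowFamily_flatVar hP ⟨e.1, e.2⟩).exists_ringHom e
  have hle : (hallIdeal M).restrictScalars ℤ ≤ LinearMap.ker (hallDeg M) := by
    intro p hp
    have := hp 1
    rwa [one_mul] at this
  refine ⟨((((hallIdeal M).restrictScalars ℤ).liftQ (hallDeg M) hle).comp
    (Submodule.Quotient.restrictScalarsEquiv ℤ (hallIdeal M)).symm.toLinearMap).comp
      φ.toAddMonoidHom.toIntLinearMap, ?_⟩
  have h : φ (chowLin M P e ^ r) = Ideal.Quotient.mk (hallIdeal M) (MvPolynomial.X M.E ^ r) := by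
    rw [map_pow, hφ, map_pow]
  have hX : (MvPolynomial.X M.E : MvPolynomial (Set α) ℤ) ^ r =
      ((Multiset.replicate r M.E).map MvPolynomial.X).prod := by
    rw [Multiset.map_replicate, Multiset.prod_replicate]
  change ((hallIdeal M).restrictScalars ℤ).liftQ (hallDeg M) hle
    ((Submodule.Quotient.restrictScalarsEquiv ℤ (hallIdeal M)).symm (φ (chowLin M P e ^ r))) = 1
  rw [h]
  change hallDeg M (MvPolynomial.X M.E ^ r) = 1
  rw [hX, hallDeg_prod, if_pos]
  intro J hJ h0
  have hcard := Multiset.card_le_card hJ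
  rw [Multiset.card_replicate] at hcard
  obtain ⟨F, hF⟩ := Multiset.exists_mem_of_ne_zero h0
  have hFE := Multiset.eq_of_mem_replicate (Multiset.mem_of_le hJ hF)
  have : M.E ⊆ J.sup := hFE ▸ Multiset.le_sup hF
  have := rk_mono M this
  omega

end ChowFamily

/-! ### Rank jumps, dual products and their pairings. -/

section Dual

open Classical

variable {α : Type*} {M : Matroid α} {P : Finset (Set α)} {A : Type*} [CommRing A]

/-- The difference of the rank of `F` and the largest rank of a member of `K` strictly inside
`F`. -/
noncomputable def jump (M : Matroid α) (K : Finset (Set α)) (F : Set α) : ℕ :=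
  rk M F - (K.filter (· ⊂ F)).sup (rk M)

theorem jump_insert_ground {K : Finset (Set α)} {F : Set α} (hF : F ⊆ M.E) :
    jump M (insert M.E K) F = jump M K F := by
  rw [jump, jump, Finset.filter_insert, if_neg fun h => h.2 hF]

section Rank

variable [M.Finite] {K : Finset (Set α)} (hK : ∀ F ∈ K, M.IsFlat F)
include hK

theorem sup_rk_lt {F : Set α} (hF : M.IsFlat F) (hpos : 0 < rk M F) :
    (K.filter (· ⊂ F)).sup (rk M) < rk M F := by
  rw [Finset.sup_lt_iff hpos]
  intro G hG
  rw [Finset.mem_filter] at hG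
  exact rk_lt_rk (hK G hG.1) hF hG.2

/-- Each k in (rk F, rk E] is covered by the rank interval ending at a member G of least rank with k
≤ rk G. -/
theorem rk_le_rk_add_sum_jump (hE : M.E ∈ K) {F : Set α}
    (hchain : ∀ G ∈ K, F ⊆ G ∨ G ⊆ F) :
    rk M M.E ≤ rk M F + ∑ G ∈ K with F ⊂ G, jump M K G := by
  have hsub : Finset.Ioc (rk M F) (rk M M.E) ⊆ (K.filter (F ⊂ ·)).biUnion fun G =>
      Finset.Ioc ((K.filter (· ⊂ G)).sup (rk M)) (rk M G) := by
    intro k hk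
    rw [Finset.mem_Ioc] at hk
    obtain ⟨G, hG, hmin⟩ := Finset.exists_min_image (K.filter (k ≤ rk M ·)) (rk M)
      ⟨M.E, Finset.mem_filter.2 ⟨hE, hk.2⟩⟩
    rw [Finset.mem_filter] at hG
    refine Finset.mem_biUnion.2 ⟨G, Finset.mem_filter.2 ⟨hG.1, ?_⟩, Finset.mem_Ioc.2 ⟨?_, hG.2⟩⟩
    · rcases hchain G hG.1 with h | h
      · refine h.ssubset_of_ne ?_
        rintro rfl
        omega
      · have := rk_mono M h
        omega
    · rw [Finset.sup_lt_iff (by rw [Nat.bot_eq_zero]; omega)]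
      intro H hH
      rw [Finset.mem_filter] at hH
      have hlt := rk_lt_rk (hK H hH.1) (hK G hG.1) hH.2
      by_contra! hle
      have := hmin H (Finset.mem_filter.2 ⟨hH.1, hle⟩)
      omega
  have h := (Finset.card_le_card hsub).trans Finset.card_biUnion_le
  simp only [Nat.card_Ioc] at h
  change _ ≤ ∑ G ∈ K with F ⊂ G, jump M K G at h
  omega

theorem sum_jump_le (hchain : ∀ F ∈ K, ∀ G ∈ K, F ⊆ G ∨ G ⊆ F) :
    ∑ G ∈ K, jump M K G ≤ rk M M.E := by
  have hdisj : ∀ F ∈ K, ∀ G ∈ K, F ≠ G → F ⊆ G →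
      Disjoint (Finset.Ioc ((K.filter (· ⊂ F)).sup (rk M)) (rk M F))
        (Finset.Ioc ((K.filter (· ⊂ G)).sup (rk M)) (rk M G)) := by
    intro F hF G hG hne h
    rw [Finset.disjoint_left]
    intro k hk hk'
    rw [Finset.mem_Ioc] at hk hk'
    have := Finset.le_sup (f := rk M) (Finset.mem_filter.2 ⟨hF, h.ssubset_of_ne hne⟩ :
      F ∈ K.filter (· ⊂ G))
    omega
  have h := Finset.card_biUnion (s := K)
    (t := fun G => Finset.Ioc ((K.filter (· ⊂ G)).sup (rk M)) (rk M G)) (by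
    intro F hF G hG hne
    rcases hchain F hF G hG with h | h
    · exact hdisj F hF G hG hne h
    · exact (hdisj G hG F hF hne.symm h).symm)
  simp only [Nat.card_Ioc] at h
  change _ = ∑ G ∈ K, jump M K G at h
  rw [← h]
  have hsub : (K.biUnion fun G => Finset.Ioc ((K.filter (· ⊂ G)).sup (rk M)) (rk M G)) ⊆
      Finset.Ioc 0 (rk M M.E) := by
    intro k hk
    obtain ⟨G, hG, hkG⟩ := Finset.mem_biUnion.1 hk
    rw [Finset.mem_Ioc] at hkG ⊢
    have := rk_mono M (hK G hG).subset_ground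
    omega
  simpa using Finset.card_le_card hsub

end Rank

variable {x : Set α → A} {a : A}

theorem x_eq (hP : IsOrderFilter M P) {F : Set α} (hF : F ∈ P) :
    x F = hClass P x a M.E - hClass P x a F - ∑ G ∈ P with F ⊂ G, x G := by
  have h : P.filter (F ⊆ ·) = insert F (P.filter (F ⊂ ·)) := by
    ext G
    simp only [Finset.mem_filter, Finset.mem_insert]
    constructor
    · rintro ⟨hG, hFG⟩
      rcases hFG.eq_or_ssubset with h | h
      exacts [Or.inl h.symm, Or.inr ⟨hG, h⟩]
    · rintro (rfl | ⟨hG, hFG⟩)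
      exacts [⟨hF, subset_rfl⟩, ⟨hG, hFG.1⟩]
  rw [hClass_ground hP, hClass, h, Finset.sum_insert (by simp)]
  ring

/-- Solve the unitriangular system defining the h_F, from the top flats downward. -/
theorem x_mem_span [M.Finite] (hP : IsOrderFilter M P) (n : ℕ) : ∀ F ∈ P, (M.E \ F).ncard ≤ n →
    x F ∈ Submodule.span ℤ (hClass P x a '' {G | M.IsFlat G ∧ F ⊆ G}) := by
  induction n using Nat.strong_induction_on with
  | _ n ih =>
    intro F hF hn
    have hFf := hP.isFlat F hF
    rw [x_eq (x := x) (a := a) hP hF]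
    refine sub_mem (sub_mem (Submodule.subset_span ⟨_, ⟨M.ground_isFlat, hFf.subset_ground⟩, rfl⟩)
      (Submodule.subset_span ⟨_, ⟨hFf, subset_rfl⟩, rfl⟩)) (sum_mem fun G hG => ?_)
    rw [Finset.mem_filter] at hG
    have hlt := ncard_ground_diff_lt (hP.isFlat G hG.1).subset_ground hG.2
    have hsub : {H | M.IsFlat H ∧ G ⊆ H} ⊆ {H | M.IsFlat H ∧ F ⊆ H} :=
      fun H hH => ⟨hH.1, hG.2.1.trans hH.2⟩
    exact Submodule.span_mono (Set.image_mono hsub) (ih _ (hlt.trans_le hn) G hG.1 le_rfl)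

/-- The product of the variables `x_F` and of powers of the classes `h_F` that is dual to the
product of the classes `h_F` over the reduced multiset `T`. -/
noncomputable def dualProd (P : Finset (Set α)) (M : Matroid α) (x : Set α → A) (a : A)
    (T : Multiset (Set α)) : A :=
  (∏ F ∈ T.toFinset.erase M.E, x F) * ∏ F ∈ insert M.E T.toFinset,
    hClass P x a F ^ (jump M (insert M.E T.toFinset) F - 1 - T.count F)

/-- This keeps the exponents of `dualProd` from being truncated, also at E when E is not in T. -/
theorem count_lt_jump [M.Finite] {T : Multiset (Set α)} (hT : IsReduced M 0 T)
    (hTf : ∀ F ∈ T, M.IsFlat F) (hE : 0 < rk M M.E) {F : Set α}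
    (hF : F ∈ insert M.E T.toFinset) :
    T.count F < jump M (insert M.E T.toFinset) F := by
  have hf : ∀ F ∈ insert M.E T.toFinset, M.IsFlat F := by
    intro F hF
    rcases Finset.mem_insert.1 hF with rfl | hF
    exacts [M.ground_isFlat, hTf F (Multiset.mem_toFinset.1 hF)]
  rw [jump_insert_ground (hf F hF).subset_ground, jump]
  by_cases hFT : F ∈ T
  · have h := hT.count_add_lt F hFT
    have : (T.toFinset.filter (· ⊂ F)).sup (rk M) < rk M F - T.count F := by
      rw [Finset.sup_lt_iff (by rw [Nat.bot_eq_zero]; omega)]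
      intro G hG
      rw [Finset.mem_filter, Multiset.mem_toFinset] at hG
      have := hT.count_add_rk_lt F hFT G hG.1 hG.2
      omega
    omega
  · obtain rfl : F = M.E := by simpa [hFT] using hF
    rw [Multiset.count_eq_zero_of_notMem hFT]
    have := sup_rk_lt (K := T.toFinset) (fun F hF => hTf F (Multiset.mem_toFinset.1 hF))
      M.ground_isFlat hE
    omega

namespace IsChowFamily

variable (hx : IsChowFamily M P x a) (hP : IsOrderFilter M P) [M.Finite]
include hx hP

theorem hClass_pow_mul_pow {F : Set α} (hF : M.IsFlat F) (hFE : F ⊂ M.E) {c : ℕ}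
    (hc : rk M M.E ≤ rk M F + c) (m : ℕ) :
    hClass P x a F ^ m * hClass P x a M.E ^ c = hClass P x a M.E ^ (c + m) := by
  induction m with
  | zero => simp
  | succ m ih =>
    rw [pow_succ', mul_assoc, ih, hx.hClass_mul_pow hP hF M.ground_isFlat hFE (by omega), add_assoc]

/-- Remove the top member F of the chain. Against the power of h_E present, x_F acts as h_E - h_F;
the h_F term completes a power of h_F killed by the rest of the chain, and in the other term the
powers of h_F turn into powers of h_E. -/
theorem prod_x_mul_prod_hClass [M.Loopless] (n : ℕ) : ∀ K : Finset (Set α), K.card = n → K ⊆ P →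
    (∀ F ∈ K, ∀ G ∈ K, F ⊆ G ∨ G ⊆ F) →
    (∏ F ∈ K, x F * hClass P x a F ^ (jump M K F - 1)) * hClass P x a M.E ^ (jump M K M.E - 1) =
      hClass P x a M.E ^ (rk M M.E - 1) := by
  induction n with
  | zero =>
    intro K hK _ _
    rw [Finset.card_eq_zero] at hK
    simp [hK, jump]
  | succ n ih =>
    intro K hK hKP hchain
    have hne : K.val ≠ 0 := by
      rw [Ne, Finset.val_eq_zero]
      rintro rfl
      simp at hK
    obtain ⟨F, hF, htop⟩ := exists_forall_subset_of_chain hne hchain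
    have hF' : F ∈ K := hF
    have hFP := hKP hF
    have hFf := hP.isFlat F hFP
    have hFE : F ⊂ M.E := hFf.subset_ground.ssubset_of_ne (hP.ne_ground F hFP)
    have hrkFE := rk_lt_rk hFf M.ground_isFlat hFE
    set K' := K.erase F with hK'
    have hKf : ∀ G ∈ K', M.IsFlat G := fun G hG => hP.isFlat G (hKP (Finset.mem_of_mem_erase hG))
    have htop' : ∀ G ∈ K', G ⊂ F := fun G hG =>
      (htop G (Finset.mem_of_mem_erase hG)).ssubset_of_ne (Finset.ne_of_mem_erase hG)
    have hfilter : ∀ H, ¬ F ⊂ H → K.filter (· ⊂ H) = K'.filter (· ⊂ H) := by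
      intro H hH
      rw [← Finset.insert_erase hF', Finset.filter_insert, if_neg hH]
    have hjump : ∀ G ∈ K', jump M K G = jump M K' G := by
      intro G hG
      rw [jump, jump, hfilter G fun h => h.2 (htop G (Finset.mem_of_mem_erase hG))]
    set p := K'.sup (rk M) with hp
    have hpF : K.filter (· ⊂ F) = K' := by
      rw [hfilter F (ssubset_irrefl F), Finset.filter_true_of_mem htop']
    have hpE : K'.filter (· ⊂ M.E) = K' :=
      Finset.filter_true_of_mem fun G hG => (htop' G hG).trans hFE
    have hKE : (K.filter (· ⊂ M.E)).sup (rk M) = rk M F := by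
      refine le_antisymm (Finset.sup_le fun G hG => rk_mono M (htop G ?_)) ?_
      · exact (Finset.mem_filter.1 hG).1
      · exact Finset.le_sup (f := rk M) (Finset.mem_filter.2 ⟨hF', hFE⟩)
    have hpos := rk_pos hFf (hP.nonempty F hFP)
    have hplt : p < rk M F := by
      rw [hp, Finset.sup_lt_iff (by rwa [Nat.bot_eq_zero])]
      exact fun G hG => rk_lt_rk (hKf G hG) hFf (htop' G hG)
    have hIH := ih K' (by rw [hK', Finset.card_erase_of_mem hF', hK]; rfl)
      ((Finset.erase_subset _ _).trans hKP) fun F hF G hG =>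
        hchain F (Finset.mem_of_mem_erase hF) G (Finset.mem_of_mem_erase hG)
    -- Here p is the rank of the next member below F, or 0 if there is none; then h_F^(rk F) = 0 is
    -- used instead of x_G h_F^(rk F - p) = 0.
    have hzero : (∏ G ∈ K', x G * hClass P x a G ^ (jump M K' G - 1)) *
        hClass P x a F ^ (rk M F - p) = 0 := by
      rcases K'.eq_empty_or_nonempty with h | h
      · rw [hx.hClass_pow_eq_zero hP (Finset.mem_insert_of_mem hFP), mul_zero]
        simp [hp, h]
      · obtain ⟨G, hG, hGp⟩ := Finset.exists_mem_eq_sup K' h (rk M)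
        have h0 := hx.x_mul_pow hP (hKP (Finset.mem_of_mem_erase hG)) hFf (htop' G hG)
          (c := rk M F - p) (by omega)
        rw [← Finset.mul_prod_erase _ _ hG]
        linear_combination (hClass P x a G ^ (jump M K' G - 1) *
          ∏ G ∈ K'.erase G, x G * hClass P x a G ^ (jump M K' G - 1)) * h0
    have hxF : x F * hClass P x a M.E ^ (rk M M.E - rk M F - 1) =
        (hClass P x a M.E - hClass P x a F) * hClass P x a M.E ^ (rk M M.E - rk M F - 1) := by
      have h0 : (∑ G ∈ P with F ⊂ G, x G) * hClass P x a M.E ^ (rk M M.E - rk M F - 1) = 0 := by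
        rw [Finset.sum_mul]
        refine Finset.sum_eq_zero fun G hG => ?_
        rw [Finset.mem_filter] at hG
        have hGf := hP.isFlat G hG.1
        have := rk_lt_rk hFf hGf hG.2
        exact hx.x_mul_pow hP hG.1 M.ground_isFlat
          (hGf.subset_ground.ssubset_of_ne (hP.ne_ground G hG.1)) (by omega)
      have h1 := x_eq (x := x) (a := a) hP hFP
      linear_combination hClass P x a M.E ^ (rk M M.E - rk M F - 1) * h1 - h0
    have hpow := hx.hClass_pow_mul_pow hP hFf hFE (c := rk M M.E - rk M F - 1 + 1) (by omega)
      (rk M F - p - 1)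
    have e1 : jump M K F = rk M F - p := by rw [jump, hpF]
    have e2 : jump M K M.E = rk M M.E - rk M F := by rw [jump, hKE]
    have e3 : jump M K' M.E - 1 = rk M M.E - rk M F - 1 + 1 + (rk M F - p - 1) := by
      rw [jump, hpE]
      omega
    have e4 : rk M F - p = rk M F - p - 1 + 1 := by omega
    have hprod : ∏ G ∈ K', x G * hClass P x a G ^ (jump M K G - 1) =
        ∏ G ∈ K', x G * hClass P x a G ^ (jump M K' G - 1) :=
      Finset.prod_congr rfl fun G hG => by rw [hjump G hG]
    rw [e4] at hzero
    rw [← hIH, ← Finset.mul_prod_erase _ _ hF', hprod, e1, e2, e3]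
    set W := ∏ G ∈ K', x G * hClass P x a G ^ (jump M K' G - 1)
    linear_combination hClass P x a F ^ (rk M F - p - 1) * W * hxF + W * hpow -
      hClass P x a M.E ^ (rk M M.E - rk M F - 1) * hzero

/-- The pairing of the product over a reduced multiset with its dual. -/
theorem prod_mul_dualProd_self [M.Loopless] (hE : 0 < rk M M.E) {T : Multiset (Set α)}
    (hT : IsReduced M 0 T) (hTP : ∀ F ∈ T, F ∈ insert M.E P) :
    (T.map (hClass P x a)).prod * dualProd P M x a T = hClass P x a M.E ^ (rk M M.E - 1) := by
  have hTf : ∀ F ∈ T, M.IsFlat F := fun F hF => hP.isFlat' (hTP F hF)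
  have hprod : (T.map (hClass P x a)).prod =
      ∏ F ∈ insert M.E T.toFinset, hClass P x a F ^ T.count F := by
    rw [Finset.prod_multiset_map_count]
    refine Finset.prod_subset (Finset.subset_insert _ _) fun F _ hF => ?_
    rw [Multiset.mem_toFinset] at hF
    rw [Multiset.count_eq_zero_of_notMem hF, pow_zero]
  set K := T.toFinset.erase M.E with hK
  have hKi : insert M.E T.toFinset = insert M.E K := by
    rw [hK]
    ext F
    by_cases h : F = M.E <;> simp [h]
  have hEK : M.E ∉ K := Finset.notMem_erase _ _
  have hKT : ∀ F ∈ K, F ∈ T := fun F hF =>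
    Multiset.mem_toFinset.1 (Finset.mem_of_mem_erase hF)
  rw [hprod, dualProd, mul_left_comm, ← Finset.prod_mul_distrib]
  have hcongr : ∀ F ∈ insert M.E T.toFinset, hClass P x a F ^ T.count F *
      hClass P x a F ^ (jump M (insert M.E T.toFinset) F - 1 - T.count F) =
        hClass P x a F ^ (jump M K F - 1) := by
    intro F hF
    have hlt := count_lt_jump hT hTf hE hF
    have hFE : F ⊆ M.E := by
      rcases Finset.mem_insert.1 hF with rfl | hF
      exacts [subset_rfl, (hTf F (Multiset.mem_toFinset.1 hF)).subset_ground]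
    rw [← pow_add, ← jump_insert_ground (K := K) hFE, ← hKi]
    congr 1
    omega
  rw [Finset.prod_congr rfl hcongr, hKi, Finset.prod_insert hEK, mul_left_comm,
    ← Finset.prod_mul_distrib, mul_comm]
  exact hx.prod_x_mul_prod_hClass hP _ K rfl
    (fun F hF => (Finset.mem_insert.1 (hTP F (hKT F hF))).resolve_left (Finset.ne_of_mem_erase hF))
    fun F hF G hG => hT.chain F (hKT F hF) G (hKT G hG)

/-- After multiplication by x_F every factor in S is a combination of classes h_G with F ⊂ G.
Transferring factors one by one to T reduces to `x_mul_prod_hClass_eq_zero`. -/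
theorem x_mul_prod_eq_zero {F : Set α} (hF : F ∈ P) (S : Multiset A) :
    ∀ T : Multiset (Set α), (∀ u ∈ S, x F * u ∈ Submodule.span ℤ
      ((fun G => x F * hClass P x a G) '' {G | M.IsFlat G ∧ F ⊂ G})) →
    (∀ G ∈ T, M.IsFlat G ∧ F ⊂ G) → rk M M.E ≤ S.card + T.card + rk M F →
    x F * S.prod * (T.map (hClass P x a)).prod = 0 := by
  induction S using Multiset.induction with
  | empty =>
    intro T _ hT hc
    rw [Multiset.prod_zero, mul_one]
    exact hx.x_mul_prod_hClass_eq_zero hP hF hT (by simpa using hc)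
  | cons u S ih =>
    intro T hS hT hc
    have key : ∀ b ∈ Submodule.span ℤ ((fun G => x F * hClass P x a G) ''
        {G | M.IsFlat G ∧ F ⊂ G}), b * (S.prod * (T.map (hClass P x a)).prod) = 0 := by
      intro b hb
      induction hb using Submodule.span_induction with
      | mem b hb =>
        obtain ⟨G, hG, rfl⟩ := hb
        have := ih (G ::ₘ T) (fun u hu => hS u (Multiset.mem_cons_of_mem hu)) (by
          intro H hH
          rcases Multiset.mem_cons.1 hH with rfl | hH
          exacts [hG, hT H hH]) (by
          rw [Multiset.card_cons] at hc ⊢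
          omega)
        rw [Multiset.map_cons, Multiset.prod_cons] at this
        rw [← this]
        ring
      | zero => rw [zero_mul]
      | add b c _ _ hb hc => rw [add_mul, hb, hc, add_zero]
      | smul n b _ hb => rw [smul_mul_assoc, hb, smul_zero]
    rw [Multiset.prod_cons, ← key _ (hS u (Multiset.mem_cons_self u S))]
    ring

omit [M.Finite] in
theorem x_mul_hClass_mem_span {F : Set α} (hF : F ∈ P) {G : Set α} (hG : G ⊆ M.E)
    (hGF : ¬ G ⊆ F) : x F * hClass P x a G ∈ Submodule.span ℤ
      ((fun G => x F * hClass P x a G) '' {G | M.IsFlat G ∧ F ⊂ G}) := by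
  have hFE := (hP.isFlat F hF).subset_ground
  rw [hx.x_mul_hClass_join hP hF hG hGF]
  exact Submodule.subset_span ⟨_, ⟨M.isFlat_closure _, right_subset_join hFE,
    fun h => hGF ((left_subset_join hG).trans h)⟩, rfl⟩

omit hx in
theorem x_mul_x_mem_span {F G : Set α} (hG : G ∈ P) (hFG : F ⊂ G) :
    x F * x G ∈ Submodule.span ℤ
      ((fun G => x F * hClass P x a G) '' {G | M.IsFlat G ∧ F ⊂ G}) := by
  have h := Submodule.mem_map_of_mem (f := LinearMap.mulLeft ℤ (x F))
    (x_mem_span (x := x) (a := a) hP _ G hG le_rfl)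
  rw [Submodule.map_span, Set.image_image] at h
  have hsub : {H | M.IsFlat H ∧ G ⊆ H} ⊆ {H | M.IsFlat H ∧ F ⊂ H} :=
    fun H hH => ⟨hH.1, hFG.trans_subset hH.2⟩
  exact Submodule.span_mono (Set.image_mono hsub) h

/-- The pairing of the product over a multiset with the dual of a reduced multiset vanishes if some
flat contains too few members of the former. -/
theorem prod_mul_dualProd_eq_zero (hE : 0 < rk M M.E) {C T : Multiset (Set α)}
    (hT : IsReduced M 0 T) (hTP : ∀ F ∈ T, F ∈ insert M.E P) (hCP : ∀ F ∈ C, F ⊆ M.E)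
    (hcard : C.card = T.card) {F : Set α} (hFT : F ∈ T) (hFP : F ∈ P)
    (hlt : (C.filter (· ⊆ F)).card < (T.filter (· ⊆ F)).card) :
    (C.map (hClass P x a)).prod * dualProd P M x a T = 0 := by
  have hTf : ∀ F ∈ T, M.IsFlat F := fun F hF => hP.isFlat' (hTP F hF)
  set K := insert M.E T.toFinset with hK
  have hKf : ∀ G ∈ K, M.IsFlat G := by
    intro G hG
    rcases Finset.mem_insert.1 hG with rfl | hG
    exacts [M.ground_isFlat, hTf G (Multiset.mem_toFinset.1 hG)]
  have hFE : F ⊂ M.E :=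
    (hP.isFlat F hFP).subset_ground.ssubset_of_ne (hP.ne_ground F hFP)
  have hEK : M.E ∈ K := Finset.mem_insert_self _ _
  have hsub : T.toFinset.erase M.E ⊆ P := fun G hG =>
    (Finset.mem_insert.1 (hTP G (Multiset.mem_toFinset.1 (Finset.mem_of_mem_erase hG)))).resolve_left
      (Finset.ne_of_mem_erase hG)
  set L := (T.toFinset.erase M.E).filter (F ⊂ ·) with hL
  set N := K.filter (F ⊂ ·) with hN
  have hNL : N = insert M.E L := by
    ext G
    simp only [hN, hL, hK, Finset.mem_filter, Finset.mem_insert, Finset.mem_erase]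
    by_cases h : G = M.E
    · simp [h, hFE]
    · simp [h]
  have hEL : M.E ∉ L := fun h => (Finset.mem_erase.1 (Finset.mem_filter.1 h).1).1 rfl
  set e : Set α → ℕ := fun G => jump M K G - 1 - T.count G with he
  have he' : ∀ G ∈ K, e G + 1 + T.count G = jump M K G := fun G hG => by
    have : T.count G < jump M K G := count_lt_jump hT hTf hE hG
    simp only [he]
    omega
  -- S collects the factors that act above F once x_F is present: the members of C not inside F, and
  -- the part of the dual strictly above F.
  set S : Multiset A := (C.filter fun G => ¬ G ⊆ F).map (hClass P x a) + L.val.map x +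
    ∑ G ∈ N, Multiset.replicate (e G) (hClass P x a G) with hS
  have hzero : x F * S.prod = 0 := by
    have := hx.x_mul_prod_eq_zero hP hFP S 0 ?_ (by simp) ?_
    · simpa using this
    · intro u hu
      rw [hS, Multiset.mem_add, Multiset.mem_add, Multiset.mem_sum] at hu
      rcases hu with (hu | hu) | ⟨G, hG, hu⟩
      · obtain ⟨G, hG, rfl⟩ := Multiset.mem_map.1 hu
        rw [Multiset.mem_filter] at hG
        exact hx.x_mul_hClass_mem_span hP hFP (hCP G hG.1) hG.2
      · obtain ⟨G, hG, rfl⟩ := Multiset.mem_map.1 hu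
        rw [Finset.mem_val, hL, Finset.mem_filter] at hG
        exact x_mul_x_mem_span hP (hsub hG.1) hG.2
      · rw [Multiset.eq_of_mem_replicate hu]
        rw [hN, Finset.mem_filter] at hG
        exact hx.x_mul_hClass_mem_span hP hFP (hKf G hG.1).subset_ground hG.2.2
    -- The jumps above F add up to at least rk E - rk F. The dual falls short of this by the members
    -- of T above F and by one, since E carries no x; C has at least one more member outside F than
    -- T does.
    · have h1 := rk_le_rk_add_sum_jump hKf hEK (F := F) (by
        intro G hG
        rcases Finset.mem_insert.1 hG with rfl | hG
        exacts [Or.inl hFE.1, hT.chain F hFT G (Multiset.mem_toFinset.1 hG)])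
      rw [← hN] at h1
      have h2 : S.card = (C.filter fun G => ¬ G ⊆ F).card + L.card + ∑ G ∈ N, e G := by
        rw [hS, Multiset.card_add, Multiset.card_add, Multiset.card_map, Multiset.card_map,
          Multiset.card_sum]
        simp
      have h3 : ∑ G ∈ N, jump M K G = ∑ G ∈ N, e G + N.card + ∑ G ∈ N, T.count G := by
        rw [Finset.card_eq_sum_ones, ← Finset.sum_add_distrib, ← Finset.sum_add_distrib]
        exact Finset.sum_congr rfl fun G hG => (he' G (Finset.mem_filter.1 hG).1).symm
      have h4 : N.card = L.card + 1 := by rw [hNL, Finset.card_insert_of_notMem hEL]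
      have h5 : ∑ G ∈ N, T.count G ≤ (T.filter fun G => ¬ G ⊆ F).card := by
        rw [← Multiset.toFinset_sum_count_eq]
        have : ∀ G ∈ N, T.count G = (T.filter fun G => ¬ G ⊆ F).count G := fun G hG =>
          (Multiset.count_filter_of_pos (p := fun G => ¬ G ⊆ F) (Finset.mem_filter.1 hG).2.2).symm
        rw [Finset.sum_congr rfl this]
        refine Finset.sum_le_sum_of_ne_zero fun G _ h => ?_
        rwa [Multiset.mem_toFinset, ← Multiset.count_ne_zero]
      have h6 : (C.filter (· ⊆ F)).card + (C.filter fun G => ¬ G ⊆ F).card = C.card := by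
        rw [← Multiset.card_add, Multiset.filter_add_not]
      have h7 : (T.filter (· ⊆ F)).card + (T.filter fun G => ¬ G ⊆ F).card = T.card := by
        rw [← Multiset.card_add, Multiset.filter_add_not]
      rw [Multiset.card_zero]
      omega
  have hprod : S.prod = ((C.filter fun G => ¬ G ⊆ F).map (hClass P x a)).prod * (∏ G ∈ L, x G) *
      ∏ G ∈ N, hClass P x a G ^ e G := by
    rw [hS, Multiset.prod_add, Multiset.prod_add, Multiset.prod_sum]
    simp only [Multiset.prod_replicate]
    rfl
  have hdvd : x F * S.prod ∣ (C.map (hClass P x a)).prod * dualProd P M x a T := by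
    rw [hprod, dualProd]
    have d1 : ((C.filter fun G => ¬ G ⊆ F).map (hClass P x a)).prod ∣
        (C.map (hClass P x a)).prod :=
      Multiset.prod_dvd_prod_of_le (Multiset.map_le_map (Multiset.filter_le _ _))
    have d2 : x F * ∏ G ∈ L, x G ∣ ∏ G ∈ T.toFinset.erase M.E, x G := by
      rw [← Finset.prod_insert (show F ∉ L from fun h => (Finset.mem_filter.1 h).2.2 subset_rfl)]
      refine Finset.prod_dvd_prod_of_subset _ _ _ (Finset.insert_subset ?_ ?_)
      · exact Finset.mem_erase.2 ⟨hFE.ne, Multiset.mem_toFinset.2 hFT⟩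
      · exact Finset.filter_subset _ _
    have d3 : ∏ G ∈ N, hClass P x a G ^ e G ∣ ∏ G ∈ K, hClass P x a G ^ e G :=
      Finset.prod_dvd_prod_of_subset _ _ _ (Finset.filter_subset _ _)
    have := mul_dvd_mul d1 (mul_dvd_mul d2 d3)
    refine Dvd.dvd.trans (dvd_of_eq ?_) this
    ring
  rw [hzero] at hdvd
  exact zero_dvd_iff.1 hdvd

end IsChowFamily

end Dual

/-! ### Graded pieces, their generators and the degree of the dual products. -/

section Graded

open Classical Pointwise

variable {α : Type*} {M : Matroid α} {P : Finset (Set α)}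

theorem one_mem_chowPiece : (1 : ChowRing M P) ∈ chowPiece M P 0 :=
  ⟨1, MvPolynomial.isHomogeneous_one _ _, rfl⟩

theorem pow_mem_chowPiece {b : ChowRing M P} (hb : b ∈ chowPiece M P 1) (n : ℕ) :
    b ^ n ∈ chowPiece M P n := by
  induction n with
  | zero => rw [pow_zero]; exact one_mem_chowPiece
  | succ n ih => rw [pow_succ]; exact mul_mem_chowPiece rfl ih hb

theorem prod_mem_chowPiece {β : Type*} (s : Finset β) (f : β → ChowRing M P) (d : β → ℕ)
    (h : ∀ i ∈ s, f i ∈ chowPiece M P (d i)) : ∏ i ∈ s, f i ∈ chowPiece M P (∑ i ∈ s, d i) := by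
  induction s using Finset.induction_on with
  | empty => exact one_mem_chowPiece
  | insert i s hi ih =>
    rw [Finset.prod_insert hi, Finset.sum_insert hi]
    exact mul_mem_chowPiece rfl (h i (Finset.mem_insert_self i s))
      (ih fun j hj => h j (Finset.mem_insert_of_mem hj))

theorem multiset_prod_mem_chowPiece {β : Type*} (f : β → ChowRing M P)
    (h : ∀ i, f i ∈ chowPiece M P 1) (S : Multiset β) :
    (S.map f).prod ∈ chowPiece M P S.card := by
  induction S using Multiset.induction with
  | empty => exact one_mem_chowPiece
  | cons i S ih =>
    rw [Multiset.map_cons, Multiset.prod_cons, Multiset.card_cons, add_comm]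
    exact mul_mem_chowPiece rfl (h i) ih

theorem mk_mem_chowPiece {f : PolyRing M P} {n : ℕ} (hf : f.IsHomogeneous n) :
    Ideal.Quotient.mk (relIdeal M P) f ∈ chowPiece M P n :=
  ⟨f, hf, rfl⟩

theorem chowVar_mem_chowPiece (F : Set α) : chowVar M P F ∈ chowPiece M P 1 := by
  rw [chowVar]
  split_ifs
  · exact mk_mem_chowPiece (MvPolynomial.isHomogeneous_X _ _)
  · exact zero_mem _

theorem chowLin_mem_chowPiece (e : {i // i ∈ M.E}) : chowLin M P e ∈ chowPiece M P 1 :=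
  mk_mem_chowPiece ((MvPolynomial.isHomogeneous_X _ _).add
    (MvPolynomial.IsHomogeneous.sum _ _ _ fun _ _ => MvPolynomial.isHomogeneous_X _ _))

theorem hClass_mem_chowPiece (e : {i // i ∈ M.E}) (F : Set α) :
    hClass P (chowVar M P) (chowLin M P e) F ∈ chowPiece M P 1 :=
  sub_mem (chowLin_mem_chowPiece e) (sum_mem fun _ _ => chowVar_mem_chowPiece _)

theorem chowPiece_zero_le : chowPiece M P 0 ≤ Submodule.span ℤ {1} := by
  rw [chowPiece, MvPolynomial.homogeneousSubmodule_zero]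
  rintro _ ⟨f, hf, rfl⟩
  obtain ⟨n, rfl⟩ := Submodule.mem_one.1 hf
  rw [Submodule.mem_span_singleton]
  exact ⟨n, by simp⟩

theorem exists_multiset_of_mem_pow {A : Type*} [CommRing A] (h : Set α → A) (R : Set (Set α))
    (n : ℕ) : ∀ b ∈ (h '' R) ^ n, ∃ S : Multiset (Set α), (∀ F ∈ S, F ∈ R) ∧ S.card = n ∧
      b = (S.map h).prod := by
  induction n with
  | zero =>
    intro b hb
    rw [pow_zero, Set.mem_one] at hb
    exact ⟨0, by simp, rfl, by simp [hb]⟩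
  | succ n ih =>
    intro b hb
    rw [pow_succ, Set.mem_mul] at hb
    obtain ⟨c, hc, _, ⟨F, hF, rfl⟩, rfl⟩ := hb
    obtain ⟨S, hS, hSc, rfl⟩ := ih c hc
    refine ⟨F ::ₘ S, ?_, by rw [Multiset.card_cons, hSc], ?_⟩
    · intro G hG
      rcases Multiset.mem_cons.1 hG with rfl | hG
      exacts [hF, hS G hG]
    · rw [Multiset.map_cons, Multiset.prod_cons, mul_comm]

variable [M.Finite]

/-- In degree one, x_F is a combination of the h_G by `x_mem_span`, and x_i = h_E - ∑ x_F; the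
degree q piece is the q-th power of this span. -/
theorem chowPiece_le_span_pow (hP : IsOrderFilter M P) (e : {i // i ∈ M.E}) (q : ℕ) :
    chowPiece M P q ≤ Submodule.span ℤ
      ((hClass P (chowVar M P) (chowLin M P e) '' {F | F ∈ insert M.E P}) ^ q) := by
  set h := hClass P (chowVar M P) (chowLin M P e) with hh
  have hvar : ∀ F ∈ P, chowVar M P F ∈ Submodule.span ℤ (h '' {F | F ∈ insert M.E P}) := by
    intro F hF
    have hsub : {G | M.IsFlat G ∧ F ⊆ G} ⊆ {F | F ∈ insert M.E P} := fun G hG =>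
      hP.mem_of_subset' (Finset.mem_insert_of_mem hF) hG.1 hG.2
    exact Submodule.span_mono (Set.image_mono hsub) (x_mem_span hP _ F hF le_rfl)
  have hone : (MvPolynomial.homogeneousSubmodule (Vars M P) ℤ 1).map
      (Ideal.Quotient.mkₐ ℤ (relIdeal M P)).toLinearMap ≤
        Submodule.span ℤ (h '' {F | F ∈ insert M.E P}) := by
    rw [MvPolynomial.homogeneousSubmodule_one_eq_span_X, Submodule.map_span, Submodule.span_le]
    rintro _ ⟨_, ⟨v, rfl⟩, rfl⟩
    rcases v with i | F
    · change Ideal.Quotient.mk (relIdeal M P) (xE M P i) ∈ _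
      rw [← hClass_chowVar_singleton e i, hClass]
      refine sub_mem (Submodule.subset_span ⟨M.E, Finset.mem_insert_self _ _, ?_⟩)
        (sum_mem fun F hF => hvar F (Finset.mem_filter.1 hF).1)
      exact hClass_ground hP
    · have := hvar F.1 F.2
      rwa [chowVar, dif_pos F.2] at this
  rw [chowPiece, ← MvPolynomial.homogeneousSubmodule_one_pow, ← Submodule.span_pow]
  have := Submodule.map_pow (MvPolynomial.homogeneousSubmodule (Vars M P) ℤ 1)
    (Ideal.Quotient.mkₐ ℤ (relIdeal M P)) q
  exact this.trans_le (pow_le_pow_left' hone q)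

theorem chowPiece_le_reducedSpan (hP : IsOrderFilter M P) (e : {i // i ∈ M.E}) (q : ℕ) :
    chowPiece M P q ≤ reducedSpan M (hClass P (chowVar M P) (chowLin M P e)) 1 0
      {F | F ∈ insert M.E P} q := by
  refine (chowPiece_le_span_pow hP e q).trans (Submodule.span_le.2 fun b hb => ?_)
  obtain ⟨S, hS, rfl, rfl⟩ := exists_multiset_of_mem_pow _ _ _ b hb
  have hx := isChowFamily_chowVar (M := M) (P := P) e
  have := hx.mul_prod_mem_reducedSpan hP (z := 1) (n₀ := 0) (R := {F | F ∈ insert M.E P})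
    (fun F hF => hP.isFlat' hF) (fun F hF G hG h => hP.mem_of_subset' hF hG h)
    (fun F hF c hc => by rw [one_mul]; exact hx.hClass_pow_eq_zero hP hF hc) _ S hS
    (Nat.lt_add_left _ (Nat.lt_succ_self _))
  rwa [one_mul] at this

theorem dualProd_mem_chowPiece (hP : IsOrderFilter M P) (e : {i // i ∈ M.E})
    (hE : 0 < rk M M.E) {T : Multiset (Set α)} (hT : IsReduced M 0 T)
    (hTP : ∀ F ∈ T, F ∈ insert M.E P) :
    dualProd P M (chowVar M P) (chowLin M P e) T ∈ chowPiece M P (rk M M.E - 1 - T.card) := by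
  have hTf : ∀ F ∈ T, M.IsFlat F := fun F hF => hP.isFlat' (hTP F hF)
  set K := insert M.E T.toFinset with hK
  have hKf : ∀ G ∈ K, M.IsFlat G := by
    intro G hG
    rcases Finset.mem_insert.1 hG with rfl | hG
    exacts [M.ground_isFlat, hTf G (Multiset.mem_toFinset.1 hG)]
  have hchain : ∀ F ∈ K, ∀ G ∈ K, F ⊆ G ∨ G ⊆ F := by
    intro F hF G hG
    rcases Finset.mem_insert.1 hF with rfl | hF'
    · exact Or.inr (hKf G hG).subset_ground
    rcases Finset.mem_insert.1 hG with rfl | hG'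
    · exact Or.inl (hKf F hF).subset_ground
    exact hT.chain F (Multiset.mem_toFinset.1 hF') G (Multiset.mem_toFinset.1 hG')
  have h1 : rk M M.E ≤ ∑ G ∈ K, jump M K G := by
    have := rk_le_rk_add_sum_jump hKf (Finset.mem_insert_self _ _) (F := ∅)
      fun G _ => Or.inl (Set.empty_subset G)
    rw [rk_empty, zero_add] at this
    exact this.trans (Finset.sum_le_sum_of_subset (Finset.filter_subset _ _))
  have h2 := sum_jump_le hKf hchain
  have h3 : ∑ G ∈ K, jump M K G = ∑ G ∈ K, (jump M K G - 1 - T.count G) + K.card +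
      ∑ G ∈ K, T.count G := by
    rw [Finset.card_eq_sum_ones, ← Finset.sum_add_distrib, ← Finset.sum_add_distrib]
    refine Finset.sum_congr rfl fun G hG => ?_
    have : T.count G < jump M K G := count_lt_jump hT hTf hE hG
    omega
  have h4 : ∑ G ∈ K, T.count G = T.card :=
    Multiset.sum_count_eq_card fun G hG => Finset.mem_insert_of_mem (Multiset.mem_toFinset.2 hG)
  have h5 : K.card = (T.toFinset.erase M.E).card + 1 := by
    rw [hK, ← Finset.card_insert_of_notMem (Finset.notMem_erase M.E T.toFinset)]
    congr 1
    ext F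
    by_cases h : F = M.E <;> simp [h]
  refine mul_mem_chowPiece (p := (T.toFinset.erase M.E).card)
    (q := ∑ G ∈ K, (jump M K G - 1 - T.count G)) (by omega) ?_ ?_
  · rw [Finset.card_eq_sum_ones]
    exact prod_mem_chowPiece _ _ _ fun F _ => chowVar_mem_chowPiece F
  · exact prod_mem_chowPiece _ _ _ fun F _ => pow_mem_chowPiece (hClass_mem_chowPiece e F) _

end Graded

/-! ### Comparing reduced multisets by their numbers of members inside flats. -/

section Basis

open Classical

variable {α : Type*} (M : Matroid α) (P : Finset (Set α))

/-- The reduced multisets of `q` members of `P ∪ {E}`. -/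
abbrev ReducedIndex (q : ℕ) : Type _ :=
  {T : Multiset (Set α) // (∀ F ∈ T, F ∈ insert M.E P) ∧ IsReduced M 0 T ∧ T.card = q}

instance finite_reducedIndex (q : ℕ) : Finite (ReducedIndex M P q) := by
  refine Set.Finite.subset (Set.finite_Iic (q • (insert M.E P).val)) fun T hT => ?_
  rw [Set.mem_Iic, Multiset.le_iff_count]
  intro F
  by_cases hF : F ∈ T
  · rw [Multiset.count_nsmul, Multiset.count_eq_one_of_mem (insert M.E P).nodup (hT.1 F hF), mul_one,
      ← hT.2.2]
    exact Multiset.count_le_card F T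
  · rw [Multiset.count_eq_zero_of_notMem hF]
    exact Nat.zero_le _

variable {M P}

/-- The members of the chain T inside F are exactly those inside the largest of them. -/
theorem card_filter_le_of_forall_mem {C T : Multiset (Set α)}
    (hT : ∀ F ∈ T, ∀ G ∈ T, F ⊆ G ∨ G ⊆ F)
    (h : ∀ F ∈ T, (T.filter (· ⊆ F)).card ≤ (C.filter (· ⊆ F)).card) (F : Set α) :
    (T.filter (· ⊆ F)).card ≤ (C.filter (· ⊆ F)).card := by
  by_cases h0 : T.filter (· ⊆ F) = 0
  · rw [h0, Multiset.card_zero]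
    exact Nat.zero_le _
  · obtain ⟨G, hG, htop⟩ := exists_forall_subset_of_chain h0 fun F hF G hG =>
      hT F (Multiset.mem_of_mem_filter hF) G (Multiset.mem_of_mem_filter hG)
    rw [Multiset.mem_filter] at hG
    calc (T.filter (· ⊆ F)).card ≤ (T.filter (· ⊆ G)).card := by
          refine Multiset.card_le_card (Multiset.le_filter.2 ⟨Multiset.filter_le _ _, htop⟩)
      _ ≤ (C.filter (· ⊆ G)).card := h G hG.1
      _ ≤ (C.filter (· ⊆ F)).card :=
          Multiset.card_le_card (Multiset.monotone_filter_right _ fun H hH => hH.trans hG.2)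

theorem card_filter_subset (T : Multiset (Set α)) (F : Set α) :
    (T.filter (· ⊆ F)).card = T.count F + (T.filter (· ⊂ F)).card := by
  rw [card_eq_count_add_card_filter_ne _ F, Multiset.count_filter_of_pos (p := (· ⊆ F)) (subset_refl F),
    Multiset.filter_filter]
  congr 2
  refine Multiset.filter_congr fun G _ => ?_
  rw [ssubset_iff_subset_ne, and_comm]

theorem eq_of_card_filter_eq [M.Finite] {Q : Finset (Set α)} (hQ : ∀ F ∈ Q, M.IsFlat F)
    {C T : Multiset (Set α)}
    (hC : ∀ F ∈ C, F ∈ Q) (hT : ∀ F ∈ T, F ∈ Q)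
    (h : ∀ F ∈ Q, (T.filter (· ⊆ F)).card = (C.filter (· ⊆ F)).card) : T = C := by
  have key : ∀ n, ∀ F ∈ Q, rk M F ≤ n → T.count F = C.count F := by
    intro n
    induction n using Nat.strong_induction_on with
    | _ n ih =>
      intro F hF hn
      have h1 := h F hF
      have h2 : T.filter (· ⊂ F) = C.filter (· ⊂ F) := by
        ext G
        by_cases hGF : G ⊂ F
        · rw [Multiset.count_filter_of_pos (p := (· ⊂ F)) hGF,
            Multiset.count_filter_of_pos (p := (· ⊂ F)) hGF]
          by_cases hG : G ∈ Q
          · exact ih (rk M G) ((rk_lt_rk (hQ G hG) (hQ F hF) hGF).trans_le hn) G hG le_rfl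
          · rw [Multiset.count_eq_zero_of_notMem fun h => hG (hT G h),
              Multiset.count_eq_zero_of_notMem fun h => hG (hC G h)]
        · rw [Multiset.count_filter_of_neg (p := (· ⊂ F)) hGF,
            Multiset.count_filter_of_neg (p := (· ⊂ F)) hGF]
      rw [card_filter_subset, card_filter_subset, h2] at h1
      omega
  ext F
  by_cases hF : F ∈ Q
  · exact key _ F hF le_rfl
  · rw [Multiset.count_eq_zero_of_notMem fun h => hF (hT F h),
      Multiset.count_eq_zero_of_notMem fun h => hF (hC F h)]

end Basis

/-! ### Unimodular pairings over the integers. -/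

theorem isUnit_det_of_triangular {ι : Type*} [Fintype ι] [DecidableEq ι] (G : Matrix ι ι ℤ)
    (w : ι → ℕ) (hdiag : ∀ i, G i i = 1) (htri : ∀ i j, G i j ≠ 0 → i = j ∨ w j < w i) :
    IsUnit G.det := by
  have hb : G.BlockTriangular (OrderDual.toDual ∘ w) := by
    intro i j hij
    by_contra h
    rcases htri i j h with rfl | h
    · exact lt_irrefl _ hij
    · exact absurd h (not_lt.2 (le_of_lt (OrderDual.toDual_lt_toDual.1 hij)))
  rw [hb.det]
  refine isUnit_iff_exists_inv.2 ⟨1, ?_⟩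
  rw [mul_one]
  refine Finset.prod_eq_one fun k _ => ?_
  have : G.toSquareBlock (OrderDual.toDual ∘ w) k = 1 := by
    ext i j
    rw [Matrix.toSquareBlock_def, Matrix.of_apply]
    by_cases hij : i = j
    · rw [hij, hdiag, Matrix.one_apply_eq]
    · rw [Matrix.one_apply_ne hij]
      by_contra h
      rcases htri i.1 j.1 h with h | h
      · exact hij (Subtype.ext h)
      · have h1 : w i.1 = w j.1 := OrderDual.toDual.injective (i.2.trans j.2.symm)
        omega
  rw [this, Matrix.det_one]

section Pairing

variable {A ι : Type*} [CommRing A] [Fintype ι] [DecidableEq ι] {D : A →ₗ[ℤ] ℤ} {b b' : ι → A}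
  (hG : IsUnit (Matrix.of fun i j => D (b i * b' j)).det)
include hG

theorem eq_zero_of_forall_pairing {y : A} (hy : y ∈ Submodule.span ℤ (Set.range b))
    (h : ∀ j, D (y * b' j) = 0) : y = 0 := by
  obtain ⟨c, rfl⟩ := (Submodule.mem_span_range_iff_exists_fun ℤ).1 hy
  have hc : Matrix.vecMul c (Matrix.of fun i j => D (b i * b' j)) = 0 := by
    ext j
    rw [Pi.zero_apply, ← h j, Finset.sum_mul, map_sum, Matrix.vecMul, dotProduct]
    refine Finset.sum_congr rfl fun i _ => ?_
    rw [smul_mul_assoc, map_smul, smul_eq_mul, Matrix.of_apply]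
  rw [Matrix.eq_zero_of_vecMul_eq_zero hG.ne_zero hc]
  simp

theorem exists_forall_pairing_eq (v : ι → ℤ) :
    ∃ y ∈ Submodule.span ℤ (Set.range b'), ∀ i, D (b i * y) = v i := by
  set G := Matrix.of fun i j => D (b i * b' j) with hGdef
  set c := G⁻¹.mulVec v with hc
  refine ⟨∑ j, c j • b' j, (Submodule.mem_span_range_iff_exists_fun ℤ).2 ⟨c, rfl⟩, fun i => ?_⟩
  have h : G.mulVec c = v := by
    rw [hc, Matrix.mulVec_mulVec, Matrix.mul_nonsing_inv _ hG, Matrix.one_mulVec]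
  rw [← congrFun h i, Finset.mul_sum, map_sum, Matrix.mulVec, dotProduct]
  refine Finset.sum_congr rfl fun j _ => ?_
  rw [mul_smul_comm, map_smul, smul_eq_mul, mul_comm, hGdef, Matrix.of_apply]

end Pairing

/-! ### The unitriangular pairing matrix and Poincaré duality. -/

section Duality

open Classical

variable {α : Type*} {M : Matroid α} [M.Finite] [M.Loopless] {P : Finset (Set α)}
  (hP : IsOrderFilter M P) (e : {i // i ∈ M.E}) {r : ℕ} (hr : rk M M.E = r + 1)

/-- The product of the classes `h_F` over a reduced multiset. -/
noncomputable def basisProd (e : {i // i ∈ M.E}) {q : ℕ} (T : ReducedIndex M P q) : ChowRing M P :=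
  (T.1.map (hClass P (chowVar M P) (chowLin M P e))).prod

/-- The dual of a reduced multiset in the Chow ring. -/
noncomputable def basisDual (e : {i // i ∈ M.E}) {q : ℕ} (T : ReducedIndex M P q) : ChowRing M P :=
  dualProd P M (chowVar M P) (chowLin M P e) T.1

omit [M.Finite] [M.Loopless] in
theorem basisProd_mem {q : ℕ} (T : ReducedIndex M P q) : basisProd e T ∈ chowPiece M P q := by
  have := multiset_prod_mem_chowPiece _ (hClass_mem_chowPiece (M := M) (P := P) e) T.1
  rwa [T.2.2.2] at this

include hP in
omit [M.Loopless] in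
theorem chowPiece_le_span_basisProd (q : ℕ) :
    chowPiece M P q ≤ Submodule.span ℤ (Set.range fun T : ReducedIndex M P q => basisProd e T) := by
  refine (chowPiece_le_reducedSpan hP e q).trans (Submodule.span_mono ?_)
  rintro _ ⟨T, hT, hTr, hTc, rfl⟩
  exact ⟨⟨T, hT, hTr, hTc⟩, (one_mul _).symm⟩

include hP hr

omit [M.Loopless] in
theorem basisDual_mem {q : ℕ} (T : ReducedIndex M P q) :
    basisDual e T ∈ chowPiece M P (r - q) := by
  have := dualProd_mem_chowPiece hP e (by omega) T.2.2.1 T.2.1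
  rwa [T.2.2.2, hr, Nat.add_sub_cancel] at this

theorem isUnit_det_pairing {D : ChowRing M P →ₗ[ℤ] ℤ} (hD : D (chowLin M P e ^ r) = 1) (q : ℕ)
    [Fintype (ReducedIndex M P q)] :
    IsUnit (Matrix.of fun S T : ReducedIndex M P q => D (basisProd e S * basisDual e T)).det := by
  have hx := isChowFamily_chowVar (M := M) (P := P) e
  refine isUnit_det_of_triangular _
    -- A nonzero entry makes every summand for T at most that for C, and equality throughout forces
    -- T = C (`eq_of_card_filter_eq`).
    (fun T => ∑ F ∈ insert M.E P, (T.1.filter (· ⊆ F)).card) (fun T => ?_) fun C T h => ?_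
  · rw [Matrix.of_apply, basisProd, basisDual,
      hx.prod_mul_dualProd_self hP (by omega) T.2.2.1 T.2.1, hClass_ground hP, hr]
    exact hD
  · have hle : ∀ F ∈ T.1, (T.1.filter (· ⊆ F)).card ≤ (C.1.filter (· ⊆ F)).card := by
      intro F hF
      rcases Finset.mem_insert.1 (T.2.1 F hF) with rfl | hFP
      · rw [Multiset.filter_eq_self.2 fun G hG => (hP.isFlat' (T.2.1 G hG)).subset_ground,
          Multiset.filter_eq_self.2 fun G hG => (hP.isFlat' (C.2.1 G hG)).subset_ground,
          T.2.2.2, C.2.2.2]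
      · by_contra! hlt
        refine h ?_
        rw [Matrix.of_apply, basisProd, basisDual, hx.prod_mul_dualProd_eq_zero hP (by omega)
          T.2.2.1 T.2.1 (fun G hG => (hP.isFlat' (C.2.1 G hG)).subset_ground)
          (C.2.2.2.trans T.2.2.2.symm) hF hFP hlt, map_zero]
    replace hle := card_filter_le_of_forall_mem T.2.2.1.chain hle
    by_cases heq : ∀ F ∈ insert M.E P, (T.1.filter (· ⊆ F)).card = (C.1.filter (· ⊆ F)).card
    · exact Or.inl (Subtype.ext (eq_of_card_filter_eq (fun F hF => hP.isFlat' hF)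
        C.2.1 T.2.1 heq).symm)
    · push Not at heq
      obtain ⟨F, hF, hne⟩ := heq
      exact Or.inr (Finset.sum_lt_sum (fun G _ => hle G) ⟨F, hF, (hle F).lt_of_ne hne⟩)

/-- An element of the Chow ring of pure degree at most `r` whose pairings with the complementary
degree vanish is zero. -/
theorem eq_zero_of_degree_mul_eq_zero {D : ChowRing M P →ₗ[ℤ] ℤ}
    (hD : D (chowLin M P e ^ r) = 1) {q : ℕ} {y : ChowRing M P} (hy : y ∈ chowPiece M P q)
    (h : ∀ z ∈ chowPiece M P (r - q), D (y * z) = 0) : y = 0 := by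
  have := Fintype.ofFinite (ReducedIndex M P q)
  exact eq_zero_of_forall_pairing (isUnit_det_pairing hP e hr hD q)
    (chowPiece_le_span_basisProd hP e q hy) fun T => h _ (basisDual_mem hP e hr T)

/-- Every integer functional on a graded piece is the pairing with an element of the complementary
degree. -/
theorem exists_degree_mul_eq {D : ChowRing M P →ₗ[ℤ] ℤ} (hD : D (chowLin M P e ^ r) = 1) {q : ℕ}
    (f : chowPiece M P q →ₗ[ℤ] ℤ) :
    ∃ z ∈ chowPiece M P (r - q), ∀ y : chowPiece M P q, D (y.1 * z) = f y := by
  have := Fintype.ofFinite (ReducedIndex M P q)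
  obtain ⟨z, hz, h⟩ := exists_forall_pairing_eq (isUnit_det_pairing hP e hr hD q)
    fun T => f ⟨basisProd e T, basisProd_mem e T⟩
  refine ⟨z, ?_, ?_⟩
  · refine (Submodule.span_le.2 ?_ : _ ≤ chowPiece M P (r - q)) hz
    rintro _ ⟨T, rfl⟩
    exact basisDual_mem hP e hr T
  · rintro ⟨y, hy⟩
    obtain ⟨c, rfl⟩ := (Submodule.mem_span_range_iff_exists_fun ℤ).1
      (chowPiece_le_span_basisProd hP e q hy)
    have hsum : (⟨∑ T, c T • basisProd e T, hy⟩ : chowPiece M P q) =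
        ∑ T, c T • ⟨basisProd e T, basisProd_mem e T⟩ := by
      ext
      simp
    rw [hsum, map_sum, ← hsum, Finset.sum_mul, map_sum]
    refine Finset.sum_congr rfl fun T _ => ?_
    rw [smul_mul_assoc, map_smul, map_smul, h]

/-- Degree zero consists of integer multiples of 1, so D alone detects zero in the top degree. -/
theorem eq_zero_of_degree_eq_zero {D : ChowRing M P →ₗ[ℤ] ℤ} (hD : D (chowLin M P e ^ r) = 1)
    {y : ChowRing M P} (hy : y ∈ chowPiece M P r) (h : D y = 0) : y = 0 := by
  refine eq_zero_of_degree_mul_eq_zero hP e hr hD hy fun z hz => ?_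
  rw [Nat.sub_self] at hz
  obtain ⟨n, rfl⟩ := Submodule.mem_span_singleton.1 (chowPiece_zero_le hz)
  rw [mul_smul_comm, mul_one, map_smul, h, smul_zero]

/-- The top graded piece of the Chow ring is infinite cyclic. -/
noncomputable def chowPieceEquivInt {D : ChowRing M P →ₗ[ℤ] ℤ} (hD : D (chowLin M P e ^ r) = 1) :
    chowPiece M P r ≃ₗ[ℤ] ℤ :=
  LinearEquiv.ofBijective (D.comp (chowPiece M P r).subtype) <| by
    constructor
    · rw [← LinearMap.ker_eq_bot, LinearMap.ker_eq_bot']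
      exact fun y hy => Subtype.ext (eq_zero_of_degree_eq_zero hP e hr hD y.2 hy)
    · intro n
      refine ⟨n • ⟨chowLin M P e ^ r, pow_mem_chowPiece (chowLin_mem_chowPiece e) r⟩, ?_⟩
      rw [map_smul]
      simp [hD]

theorem bijective_chowPairing {D : ChowRing M P →ₗ[ℤ] ℤ} (hD : D (chowLin M P e ^ r) = 1)
    {q : ℕ} (hq : q ≤ r) : Function.Bijective (chowPairing M P (Nat.sub_add_cancel hq)) := by
  constructor
  · rw [← LinearMap.ker_eq_bot, LinearMap.ker_eq_bot']
    intro b hb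
    refine Subtype.ext (eq_zero_of_degree_mul_eq_zero hP e hr hD b.2 fun z hz => ?_)
    rw [Nat.sub_sub_self hq] at hz
    have h : z * b.1 = 0 := congrArg Subtype.val (LinearMap.congr_fun hb ⟨z, hz⟩)
    rw [mul_comm, h, map_zero]
  · intro f
    obtain ⟨z, hz, h⟩ := exists_degree_mul_eq hP e hr hD
      ((D.comp (chowPiece M P r).subtype).comp f)
    refine ⟨⟨z, hz⟩, LinearMap.ext fun y => (chowPieceEquivInt hP e hr hD).injective ?_⟩
    exact h y

theorem isAddTorsionFree_chowPiece {D : ChowRing M P →ₗ[ℤ] ℤ} (hD : D (chowLin M P e ^ r) = 1)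
    (q : ℕ) : IsAddTorsionFree (chowPiece M P q) := by
  refine ⟨fun n hn y y' h => ?_⟩
  rw [← sub_eq_zero]
  -- The case q > r is included: a reduced multiset has at most r members, so there are none with q
  -- members and the piece is zero.
  refine Subtype.ext (eq_zero_of_degree_mul_eq_zero hP e hr hD (y - y').2 fun z _ => ?_)
  have h0 : n • (y - y') = 0 := by
    rw [smul_sub, sub_eq_zero]
    exact h
  have h1 : n • (y - y').1 = 0 := congrArg Subtype.val h0
  have h2 : n • D ((y - y').1 * z) = 0 := by
    rw [← map_nsmul, ← smul_mul_assoc, h1, zero_mul, map_zero]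
  exact (smul_eq_zero.1 h2).resolve_left hn

end Duality

end MatroidChow

theorem mainTheorem4 {α : Type*} (M : Matroid α) [M.Finite] [M.Loopless] (r : ℕ)
    (hr : M.eRank = (r : ℕ∞) + 1) (P : Finset (Set α)) (hP : MatroidChow.IsOrderFilter M P) :
    Nonempty (MatroidChow.chowPiece M P r ≃ₗ[ℤ] ℤ) ∧
    (∀ (q : ℕ) (hq : q ≤ r),
      Function.Bijective (MatroidChow.chowPairing M P (Nat.sub_add_cancel hq))) ∧
    (∀ q : ℕ, IsAddTorsionFree (MatroidChow.chowPiece M P q)) := by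
  have hrk : MatroidChow.rk M M.E = r + 1 := by
    have h := MatroidChow.coe_rk M M.E
    rw [M.eRk_ground, hr] at h
    exact_mod_cast h
  have hne : M.E.Nonempty := by
    rw [Set.nonempty_iff_ne_empty]
    intro h
    rw [h, MatroidChow.rk_empty] at hrk
    omega
  obtain ⟨i, hi⟩ := hne
  obtain ⟨D, hD⟩ := MatroidChow.exists_degree hP ⟨i, hi⟩ (r := r) (by omega)
  exact ⟨⟨MatroidChow.chowPieceEquivInt hP ⟨i, hi⟩ hrk hD⟩,
    fun q hq => MatroidChow.bijective_chowPairing hP ⟨i, hi⟩ hrk hD hq,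
    MatroidChow.isAddTorsionFree_chowPiece hP ⟨i, hi⟩ hrk hD⟩
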